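/- Conventions. $d$ is the Euclidean distance, $d(A,B)=\inf\{d(a,b):a\in A,\ b\in B\}$, and $h(A,B)\in[0,\infty]$ is the Hausdorff distance of nonempty sets. For families $\{M_i\}_{i\in I}$, $\{N_j\}_{j\in J}$ of subsets of $\mathbb{R}^2$ put $$h(\{M_i\},\{N_j\})=\sup_{i\in I,\,j\in J}\Big\{\inf_{j'\in J}h(M_i,N_{j'}),\ \inf_{i'\in I}h(M_{i'},N_j)\Big\}.$$ A $\delta$-symmetry group of $\{M_i\}$ is a group $\mathcal{G}$ of isometries $\varphi$ of $\mathbb{R}^2$ with $h(\{\varphi(M_i)\},\{M_i\})\le\delta$. A $\langle\delta,\delta_0\rangle$-pattern with the $\delta$-symmetry group $\mathcal{G}$ is a nonempty family $\{M_i\}_{i\in I}$ of nonempty pairwise disjoint sets for which there are $g_{ij}\in\mathcal{G}$ $(i,j\in I)$ such that $h(M_i,g_{ij}(M_j))\le\delta_0$ for all $i,j$ and $\{g_{ij}:i,j\in I\}$ is a subgroup of $\mathcal{G}$; a $\delta$-pattern is a $\langle\delta,\delta\rangle$-pattern. A pattern is connected if all $M_i$ are connected; it is $d_0$-discrete if all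 $M_i$ are bounded, $\#I\ge 2$ and $d_0=\inf\{d(M_i,M_j):i\ne j\}>0$. The infield $\mathrm{In}(A)$ of $A$ is the complement of the unbounded component of $\mathbb{R}^2\setminus A$. A pattern is separated if the sets $\mathrm{In}(M_i)$ are pairwise disjoint, and fine-distributed if there are $r_0,R_0>0$ such that each $\mathrm{In}(M_i)$ contains a ball of radius $r_0$ and is contained in a ball of radius $R_0$. A nonempty set $A$ is $\lambda$-exterior open topology-free if $\{x:d(x,\mathrm{In}(A))<\lambda\}$ is simply connected. For patterns $\mathfrak{P}=\{M_i\}_{i\in I}$ and $\mathfrak{Q}=\{N_i\}_{i\in I}$ with the same index set, $\mathfrak{Q}$ $\langle\delta_1,\delta_2\rangle$-engulfs $\mathfrak{P}$ with the groups $\mathcal{G}_1\subseteq\mathcal{G}_2$ if $M_i\subseteq N_i$ for all $i$, $\mathcal{G}_1$ is a $\delta_1$-symmetry group of $\mathfrak{P}$ and $\mathcal{G}_2$ is a $\delta_2$-symmetry group of $\mathfrak{Q}$. Proposition. Let $\delta\ge 0$, $d_0>4\delta$ and $0<\varepsilon_0<\frac{d_0-4\delta}{2}$. There is $\varepsilon_1>0$,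 depending only on $\delta,d_0,\varepsilon_0$, such that the following holds for every $d_0$-discrete connected $\delta$-pattern $\mathfrak{P}=\{M_i:i\in I\}$ in $\mathbb{R}^2$ with $\delta$-symmetry group $\mathcal{G}_1$. (1) There are a group $\mathcal{G}_2\supseteq\mathcal{G}_1$ and a separated, fine-distributed, connected $\langle 4\delta+2\varepsilon_0,0\rangle$-pattern $\mathfrak{Q}$ with the $(4\delta+2\varepsilon_0)$-symmetry group $\mathcal{G}_2$ such that $\mathfrak{Q}$ $\langle\delta,4\delta+2\varepsilon_0\rangle$-engulfs $\mathfrak{P}$ with the groups $\mathcal{G}_1\subseteq\mathcal{G}_2$. (2) If, for some $0<\varepsilon<\varepsilon_1$, some $M_{i_0}$ is $\lambda$-exterior open topology-free with $\lambda=5\delta+3\varepsilon_0+\varepsilon$, then there are such $\mathcal{G}_2$ and $\mathfrak{Q}$ for which, in addition, every member of $\mathfrak{Q}$ is an open topological disk (an open set homeomorphic to the open unit disk). -/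

import Mathlib

open scoped ENNReal

namespace QuasiPattern

/-- Hausdorff-type distance between two indexed families of sets,
`h({M_i}, {N_j}) = sup_{i, j} {inf_{j'} h(M_i, N_{j'}), inf_{i'} h(M_{i'}, N_j)}`,
with values in `[0, ∞]`. -/
noncomputable def familyDist {X ι κ : Type*} [PseudoEMetricSpace X]
    (M : ι → Set X) (N : κ → Set X) : ℝ≥0∞ :=
  (⨆ i, ⨅ j, Metric.hausdorffEDist (M i) (N j)) ⊔ (⨆ j, ⨅ i, Metric.hausdorffEDist (M i) (N j))

/-- The isometry `φ` of `X` onto itself is a `δ`-symmetry of the family `M`. -/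
def IsSymmetry {X ι : Type*} [PseudoEMetricSpace X] (δ : ℝ) (M : ι → Set X) (φ : X ≃ᵢ X) : Prop :=
  familyDist (fun i => φ '' M i) M ≤ ENNReal.ofReal δ

/-- `G` is a `δ`-symmetry group of the family `M`: a group of `δ`-symmetries. -/
def IsSymmetryGroup {X ι : Type*} [PseudoEMetricSpace X] (δ : ℝ) (M : ι → Set X)
    (G : Subgroup (X ≃ᵢ X)) : Prop :=
  ∀ φ ∈ G, IsSymmetry δ M φ

/-- The family `M` is a (monomotif) `⟨δ, δ₀⟩`-quasi-pattern with respect to the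
`δ`-symmetry group `G`. -/
structure IsPattern {X ι : Type*} [PseudoEMetricSpace X] (δ δ₀ : ℝ) (M : ι → Set X)
    (G : Subgroup (X ≃ᵢ X)) : Prop where
  nonempty_index : Nonempty ι
  nonempty : ∀ i, (M i).Nonempty
  isSymmetryGroup : IsSymmetryGroup δ M G
  disjoint : ∀ i j, i ≠ j → Disjoint (M i) (M j)
  exists_transfer : ∃ g : ι → ι → (X ≃ᵢ X),
    (∀ i j, g i j ∈ G ∧ Metric.hausdorffEDist (M i) (g i j '' M j) ≤ ENNReal.ofReal δ₀) ∧
    ∃ G' : Subgroup (X ≃ᵢ X), G' ≤ G ∧ (G' : Set (X ≃ᵢ X)) = {φ | ∃ i j, φ = g i j}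

/-- All members of the family are connected. -/
def IsConnectedFamily {X ι : Type*} [TopologicalSpace X] (M : ι → Set X) : Prop :=
  ∀ i, IsConnected (M i)

/-- The distance `d(A, B) = inf {d(a, b) : a ∈ A, b ∈ B}` between two sets. -/
noncomputable def setDist {X : Type*} [PseudoEMetricSpace X] (A B : Set X) : ℝ≥0∞ :=
  ⨅ a ∈ A, ⨅ b ∈ B, edist a b

/-- The family `M` is `d₀`-discrete: bounded members, at least two indices, and
`d₀ = inf {d(M_i, M_j) : i ≠ j} > 0`. -/
structure IsDiscreteFamily {X ι : Type*} [PseudoMetricSpace X] (d₀ : ℝ) (M : ι → Set X) :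
    Prop where
  bounded : ∀ i, Bornology.IsBounded (M i)
  nontrivial_index : Nontrivial ι
  pos : 0 < d₀
  iInf_setDist : (⨅ i, ⨅ j, ⨅ _ : i ≠ j, setDist (M i) (M j)) = ENNReal.ofReal d₀

/-- The infield `In(A)`: the complement of the unbounded component of `Aᶜ`. For `x ∈ A` the set
`connectedComponentIn Aᶜ x` is empty, so that `A ⊆ In(A)`. -/
def infield {X : Type*} [PseudoMetricSpace X] (A : Set X) : Set X :=
  {x | Bornology.IsBounded (connectedComponentIn Aᶜ x)}

/-- The infields of the members are pairwise disjoint. -/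
def IsSeparated {X ι : Type*} [PseudoMetricSpace X] (M : ι → Set X) : Prop :=
  ∀ i j, i ≠ j → Disjoint (infield (M i)) (infield (M j))

/-- Every infield contains a ball of radius `r₀` and is contained in a ball of radius `R₀`, with
positive constants `r₀`, `R₀` that do not depend on the member. -/
def IsFineDistributed {X ι : Type*} [PseudoMetricSpace X] (M : ι → Set X) : Prop :=
  ∃ r₀ R₀ : ℝ, 0 < r₀ ∧ 0 < R₀ ∧ ∀ i,
    (∃ c, Metric.ball c r₀ ⊆ infield (M i)) ∧ (∃ c, infield (M i) ⊆ Metric.ball c R₀)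

/-- The family `N` `⟨δ₁, δ₂⟩`-engulfs the family `M` by means of the groups `G₁` and `G₂`. -/
structure EngulfsWith {X ι : Type*} [PseudoEMetricSpace X] (δ₁ δ₂ : ℝ) (N M : ι → Set X)
    (G₁ G₂ : Subgroup (X ≃ᵢ X)) : Prop where
  subset : ∀ i, M i ⊆ N i
  isSymmetryGroup_left : IsSymmetryGroup δ₁ M G₁
  isSymmetryGroup_right : IsSymmetryGroup δ₂ N G₂
  le : G₁ ≤ G₂

/-- The set `A` is `l`-exterior open topology-free: it is nonempty and the open
`l`-neighbourhood of its infield is simply connected. -/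
def IsExteriorOpenTopologyFree {X : Type*} [PseudoMetricSpace X] (l : ℝ) (A : Set X) : Prop :=
  A.Nonempty ∧ IsSimplyConnected (Metric.thickening l (infield A))

/-- `A` is an open topological disk in the Euclidean plane. -/
def IsOpenDisk (A : Set (EuclideanSpace ℝ (Fin 2))) : Prop :=
  IsOpen A ∧ Nonempty (A ≃ₜ Metric.ball (0 : EuclideanSpace ℝ (Fin 2)) 1)

end QuasiPattern

/-!
Put `r = δ + ε₀ / 2`, so that `4 * r < d₀`. Distinct members of the quasi-pattern are at least `d₀`
apart, hence every `φ ∈ G₁` carries each `M i` to within Hausdorff distance `r` of exactly one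
`M j`, and `G₁` acts on the indices. The union `T i` of the open `r`-neighbourhoods of all images
`φ '' M k` that are `r`-close to `M i` (`orbitThickening`) is open, connected, contains `M i`, and is
permuted *exactly* by `G₁` (`image_orbitThickening`). It lies in the `2 * r`-neighbourhood of `M i`,
which keeps the closures of different `T i` disjoint.

The engulfing pattern is `N i = infield (T i)`, with the same group `G₁`. Two infields can only meet
if one of the sets `T i`, `T j` lies inside the other; as the sets are congruent, the enclosing
infield would have a strictly larger volume than itself (`disjoint_infield_of_image_eq`).

The infield of a bounded connected open set of the plane is always an open disk
(`isOpenDisk_infield`): it is open and connected, its complement is connected and unbounded, and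
the Riemann mapping theorem applies (`nonempty_homeomorph_ball_of_compl`). The latter is proved
here for a bounded domain `U` whose complement has no bounded component:
* Runge's theorem (`exists_polynomial_norm_sub_lt`): on a compact set `K` whose complement has no
  bounded component, the Cauchy kernels with poles off `K` lie in the closed algebra generated by the
  polynomials, because passing to a closed subalgebra only adds bounded components of the resolvent
  set to the spectrum; the Cauchy–Pompeiu formula writes a holomorphic function as an integral of
  such kernels.
* Consequently holomorphic functions on `U` have primitives, and zero-free ones have square roots
  (`exists_primitive`, `exists_sqrt`).
* An injective map of `U` into the unit disk with maximal derivative at a base point exists by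
  Montel's and Hurwitz's theorems, and is onto by Koebe's square root trick
  (`nonempty_homeomorph_ball_of_sqrt`).
-/

/-! ### The Cauchy–Pompeiu formula -/

section

open Set Filter Topology MeasureTheory Metric Complex

/-- A pair of opposite sides of the square `[-L, L]²` contributes `π`, up to a unit, to `∮ dw / w`. -/
lemma integral_square_kernel {L : ℝ} (hL : 0 < L) :
    ∫ x : ℝ in -L..L, ((2 * L / (x ^ 2 + L ^ 2) : ℝ) : ℂ) = Real.pi := by
  rw [intervalIntegral.integral_ofReal]
  have h : ∀ x : ℝ, 2 * L / (x ^ 2 + L ^ 2) = (2 / L) * (1 + (x / L) ^ 2)⁻¹ := by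
    intro x
    have : x ^ 2 + L ^ 2 ≠ 0 := by positivity
    field_simp
    ring
  simp_rw [h]
  rw [intervalIntegral.integral_const_mul,
    intervalIntegral.integral_comp_div (fun y => (1 + y ^ 2)⁻¹) hL.ne', integral_inv_one_add_sq,
    neg_div, div_self hL.ne', Real.arctan_neg, Real.arctan_one]
  congr 1
  simp only [smul_eq_mul]
  field_simp
  ring

/-- `2i ∂g/∂z̄`, the density in the Cauchy–Pompeiu formula. -/
noncomputable def dbar (g : ℂ → ℂ) (w : ℂ) : ℂ := I * fderiv ℝ g w 1 - fderiv ℝ g w I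

lemma dbar_eq_zero {g : ℂ → ℂ} {w : ℂ} (h : DifferentiableAt ℂ g w) : dbar g w = 0 := by
  have h1 : fderiv ℝ g w = (fderiv ℂ g w).restrictScalars ℝ :=
    (h.hasFDerivAt.restrictScalars ℝ).fderiv
  have h2 : fderiv ℂ g w I = I * fderiv ℂ g w 1 := by
    rw [← smul_eq_mul, ← (fderiv ℂ g w).map_smul, smul_eq_mul, mul_one]
  simp [dbar, h1, h2]

lemma continuous_dbar {g : ℂ → ℂ} (hg : ContDiff ℝ 1 g) : Continuous (dbar g) := by
  have := hg.continuous_fderiv one_ne_zero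
  unfold dbar
  fun_prop

lemma support_dbar_subset (g : ℂ → ℂ) : Function.support (dbar g) ⊆ tsupport g := by
  intro w hw
  by_contra h
  apply hw
  have : fderiv ℝ g w = 0 := by
    by_contra h'
    exact h (support_fderiv_subset ℝ h')
  simp [dbar, this]

lemma continuous_inv_mul_of_eventuallyEq_zero {D : ℂ → ℂ} (hD : Continuous D)
    (h0 : ∀ᶠ w in 𝓝 0, D w = 0) : Continuous fun w => w⁻¹ * D w := by
  rw [continuous_iff_continuousAt]
  intro w
  rcases eq_or_ne w 0 with rfl | hw
  · refine ContinuousAt.congr (f := fun _ => (0 : ℂ)) continuousAt_const ?_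
    filter_upwards [h0] with x hx
    simp [hx]
  · exact (continuousAt_inv₀ hw).mul hD.continuousAt

/-- The Cauchy–Pompeiu formula at the origin, for a compactly supported function that is
holomorphic near the origin. -/
lemma integral_inv_mul_dbar {g : ℂ → ℂ} (hg : ContDiff ℝ 1 g) (hc : HasCompactSupport g)
    (hz : ∀ᶠ w in 𝓝 0, DifferentiableAt ℂ g w) :
    ∫ w : ℂ, w⁻¹ * dbar g w = -(2 * Real.pi * I) * g 0 := by
  have hgd : ∀ w, HasFDerivAt g (fderiv ℝ g w) w := fun w =>
    (hg.differentiable one_ne_zero w).hasFDerivAt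
  have hcont : Continuous fun w => w⁻¹ * dbar g w :=
    continuous_inv_mul_of_eventuallyEq_zero (continuous_dbar hg)
      (hz.mono fun w hw => dbar_eq_zero hw)
  obtain ⟨L, hL0, hL⟩ : ∃ L : ℝ, 0 < L ∧ tsupport g ⊆ ball 0 L := by
    obtain ⟨L, hL⟩ := hc.isCompact.isBounded.subset_ball 0
    exact ⟨max L 1, by positivity, hL.trans (ball_subset_ball (le_max_left _ _))⟩
  have hg0 : ∀ w : ℂ, L ≤ |w.re| ∨ L ≤ |w.im| → w ∉ tsupport g := by
    intro w hw hws
    have h1 : ‖w‖ < L := by simpa using hL hws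
    rcases hw with hw | hw
    · linarith [abs_re_le_norm w]
    · linarith [abs_im_le_norm w]
  have hsupp : ∀ w : ℂ, w⁻¹ * dbar g w ≠ 0 → |w.re| < L ∧ |w.im| < L := by
    intro w hw
    by_contra hcon
    have hcon' : L ≤ |w.re| ∨ L ≤ |w.im| := by
      by_contra h
      push Not at h
      exact hcon h
    exact hg0 w hcon' (support_dbar_subset g (right_ne_zero_of_mul hw))
  have hcs : HasCompactSupport fun w => w⁻¹ * dbar g w := by
    refine HasCompactSupport.of_support_subset_isCompact (isCompact_closedBall (0 : ℂ) L) ?_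
    intro w hw
    exact ball_subset_closedBall (hL (support_dbar_subset g (right_ne_zero_of_mul hw)))
  have hint : Integrable fun w => w⁻¹ * dbar g w := hcont.integrable_of_hasCompactSupport hcs
  have hsymm : ∀ p : ℝ × ℝ, measurableEquivRealProd.symm p = p.1 + p.2 * I :=
    fun p => mk_eq_add_mul_I p.1 p.2
  -- the iterated integral over the square is the integral over the plane
  have hplane : ∫ w : ℂ, w⁻¹ * dbar g w =
      ∫ x : ℝ in -L..L, ∫ y : ℝ in -L..L, (x + y * I : ℂ)⁻¹ * dbar g (x + y * I) := by
    have h1 : ∫ w : ℂ, w⁻¹ * dbar g w =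
        ∫ p : ℝ × ℝ, (p.1 + p.2 * I : ℂ)⁻¹ * dbar g (p.1 + p.2 * I) := by
      rw [← volume_preserving_equiv_real_prod.symm.integral_comp
        (MeasurableEquiv.measurableEmbedding _)]
      refine integral_congr_ae (ae_of_all _ fun p => ?_)
      simp only [hsymm]
    have h2 : Integrable fun p : ℝ × ℝ => (p.1 + p.2 * I : ℂ)⁻¹ * dbar g (p.1 + p.2 * I) := by
      have := (volume_preserving_equiv_real_prod.symm.integrable_comp_emb
        (MeasurableEquiv.measurableEmbedding _)).2 hint
      refine this.congr (ae_of_all _ fun p => ?_)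
      simp only [hsymm, Function.comp_apply]
    rw [h1, Measure.volume_eq_prod, integral_prod _ (by rwa [← Measure.volume_eq_prod])]
    have h3 : ∀ x : ℝ, ∫ y : ℝ in -L..L, (x + y * I : ℂ)⁻¹ * dbar g (x + y * I) =
        ∫ y : ℝ, (x + y * I : ℂ)⁻¹ * dbar g (x + y * I) := by
      intro x
      refine intervalIntegral.integral_eq_integral_of_support_subset fun y hy => ?_
      have := (hsupp _ hy).2
      simp only [add_im, ofReal_im, mul_im, ofReal_re, I_im, I_re, mul_one, mul_zero, zero_add,
        add_zero, abs_lt] at this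
      exact ⟨this.1, this.2.le⟩
    simp_rw [h3]
    refine (intervalIntegral.integral_eq_integral_of_support_subset fun x hx => ?_).symm
    by_contra hcon
    apply hx
    refine integral_eq_zero_of_ae (ae_of_all _ fun y => ?_)
    by_contra hy
    have := (hsupp _ hy).1
    simp only [add_re, ofReal_re, mul_re, ofReal_im, I_im, I_re, mul_one, mul_zero, sub_zero,
      add_zero, abs_lt] at this
    exact hcon ⟨this.1, this.2.le⟩
  -- the divergence theorem is applied to `(g w - g 0) / w`, which is continuous at the origin and
  -- reduces to `-g 0 / w` on the boundary of the square
  set F : ℂ → ℂ := dslope g 0 with hF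
  set F' : ℂ → ℂ →L[ℝ] ℂ := fun w =>
    w⁻¹ • fderiv ℝ g w - ((g w - g 0) * (w ^ 2)⁻¹) • (1 : ℂ →L[ℝ] ℂ) with hF'
  have hFne : ∀ w : ℂ, w ≠ 0 → F w = w⁻¹ * (g w - g 0) := by
    intro w hw
    simp [hF, dslope_of_ne _ hw, slope_def_field, div_eq_inv_mul]
  have hF'D : ∀ w : ℂ, w ≠ 0 → HasFDerivAt F (F' w) w := by
    intro w hw
    have ha : HasFDerivAt (fun w : ℂ => w⁻¹)
        (((1 : ℂ →L[ℂ] ℂ).smulRight (-(w ^ 2)⁻¹)).restrictScalars ℝ) w :=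
      (hasDerivAt_inv hw).hasFDerivAt.restrictScalars ℝ
    have h1 := ha.mul ((hgd w).sub_const (g 0))
    refine (h1.congr_fderiv (g' := F' w) ?_).congr_of_eventuallyEq ?_
    · refine ContinuousLinearMap.ext fun v => ?_
      simp [hF']
      ring
    filter_upwards [isOpen_ne.mem_nhds hw] with x hx
    exact hFne x hx
  have hF'dbar : ∀ w : ℂ, I • F' w 1 - F' w I = w⁻¹ * dbar g w := by
    intro w
    simp [hF', dbar]
    ring
  have hFc : Continuous F := by
    rw [continuous_iff_continuousAt]
    intro w
    rcases eq_or_ne w 0 with rfl | hw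
    · exact continuousAt_dslope_same.2 hz.self_of_nhds
    · exact (hF'D w hw).continuousAt
  have key := integral_boundary_rect_of_hasFDerivAt_real_off_countable F F'
    (-L + (-L) * I) (L + L * I) {0} (countable_singleton _) hFc.continuousOn
    (fun w hw => hF'D w hw.2) (by simp_rw [hF'dbar]; exact hint.integrableOn)
  simp_rw [hF'dbar] at key
  have hbd : ∀ w : ℂ, L ≤ |w.re| ∨ L ≤ |w.im| → F w = -g 0 * w⁻¹ := by
    intro w hw
    have hw0 : w ≠ 0 := by
      rintro rfl
      simp at hw
      linarith
    rw [hFne w hw0, image_eq_zero_of_notMem_tsupport (hg0 w hw)]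
    ring
  have e1 : ∀ x : ℝ, F (x + (-L : ℝ) * I) - F (x + (L : ℝ) * I) =
      -g 0 * I * ((2 * L / (x ^ 2 + L ^ 2) : ℝ) : ℂ) := by
    intro x
    rw [hbd _ (by right; simp [abs_of_pos hL0]), hbd _ (by right; simp [abs_of_pos hL0])]
    have h1 : (x + (-L : ℝ) * I : ℂ) ≠ 0 := by
      intro h; have := congrArg im h; simp at this; linarith
    have h2 : (x + (L : ℝ) * I : ℂ) ≠ 0 := by
      intro h; have := congrArg im h; simp at this; linarith
    have h3 : (x ^ 2 + L ^ 2 : ℂ) = (x + (-L : ℝ) * I) * (x + (L : ℝ) * I) := by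
      push_cast
      linear_combination (L ^ 2 : ℂ) * I_sq
    push_cast at h1 h2 h3 ⊢
    rw [h3]
    simp only [neg_mul, ← sub_eq_add_neg] at h1 ⊢
    field_simp
    ring
  have e2 : ∀ y : ℝ, F ((L : ℝ) + y * I) - F ((-L : ℝ) + y * I) =
      -g 0 * ((2 * L / (y ^ 2 + L ^ 2) : ℝ) : ℂ) := by
    intro y
    rw [hbd _ (by left; simp [abs_of_pos hL0]), hbd _ (by left; simp [abs_of_pos hL0])]
    have h1 : ((-L : ℝ) + y * I : ℂ) ≠ 0 := by
      intro h; have := congrArg re h; simp at this; linarith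
    have h2 : ((L : ℝ) + y * I : ℂ) ≠ 0 := by
      intro h; have := congrArg re h; simp at this; linarith
    have h3 : (y ^ 2 + L ^ 2 : ℂ) = -(((-L : ℝ) + y * I) * ((L : ℝ) + y * I)) := by
      push_cast
      linear_combination (y ^ 2 : ℂ) * I_sq
    push_cast at h1 h2 h3 ⊢
    rw [h3]
    field_simp
    ring
  have hii : ∀ f : ℝ → ℂ, Continuous f → IntervalIntegrable f volume (-L) L :=
    fun f hf => hf.intervalIntegrable _ _
  have hre1 : (-L + (-L) * I : ℂ).re = -L := by simp
  have him1 : (-L + (-L) * I : ℂ).im = -L := by simp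
  have hre2 : (L + L * I : ℂ).re = L := by simp
  have him2 : (L + L * I : ℂ).im = L := by simp
  rw [hre1, him1, hre2, him2] at key
  rw [hplane, ← key, ← intervalIntegral.integral_sub (hii _ (by fun_prop)) (hii _ (by fun_prop)),
    add_sub_assoc, ← smul_sub,
    ← intervalIntegral.integral_sub (hii _ (by fun_prop)) (hii _ (by fun_prop))]
  simp_rw [e1, e2]
  rw [intervalIntegral.integral_const_mul, intervalIntegral.integral_const_mul,
    integral_square_kernel hL0, smul_eq_mul]
  ring

end

/-! ### Runge's theorem -/

section

open Set Filter Topology MeasureTheory Metric Complex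

/-- A holomorphic function near a compact set `K` is, on `K`, a Cauchy integral with a continuous
density that is compactly supported off `K`. -/
lemma exists_eq_integral_cauchy_kernel {K U : Set ℂ} (hK : IsCompact K) (hU : IsOpen U)
    (hKU : K ⊆ U) {h : ℂ → ℂ} (hh : DifferentiableOn ℂ h U) :
    ∃ D : ℂ → ℂ, Continuous D ∧ HasCompactSupport D ∧ (∀ z ∈ K, ∀ᶠ w in 𝓝 z, D w = 0) ∧
      ∀ z ∈ K, h z = ∫ w, D w * (w - z)⁻¹ := by
  obtain ⟨V, hVo, hKV, hVU, hVc⟩ : ∃ V : Set ℂ, IsOpen V ∧ K ⊆ V ∧ closure V ⊆ U ∧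
      IsCompact (closure V) := exists_open_between_and_isCompact_closure hK hU hKU
  obtain ⟨χ, hχ1, hχ0, -⟩ := exists_contMDiffMap_one_nhds_of_subset_interior (n := 1)
    (modelWithCornersSelf ℝ ℂ) hK.isClosed (hVo.interior_eq.symm ▸ hKV)
  have hχ : ContDiff ℝ 1 χ := χ.contMDiff.contDiff
  set g : ℂ → ℂ := fun z => (χ z : ℂ) * h z with hg
  have hts : tsupport g ⊆ closure V := by
    refine closure_mono fun z hz => ?_
    by_contra hzV
    exact hz (by simp [hg, hχ0 z hzV])
  have hgc : HasCompactSupport g := hVc.of_isClosed_subset (isClosed_tsupport g) hts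
  have hgd : ContDiff ℝ 1 g := by
    rw [contDiff_iff_contDiffAt]
    intro z
    by_cases hz : z ∈ tsupport g
    · have h1 : ContDiffAt ℝ 1 h z :=
        ((hh.contDiffOn (n := 1) hU).contDiffAt (hU.mem_nhds (hVU (hts hz)))).restrict_scalars ℝ
      exact (ofRealCLM.contDiff.comp hχ).contDiffAt.mul h1
    · exact contDiffAt_const.congr_of_eventuallyEq (notMem_tsupport_iff_eventuallyEq.1 hz)
  have hgK : ∀ z ∈ K, ∀ᶠ w in 𝓝 z, w ∈ U ∧ g =ᶠ[𝓝 w] h := by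
    intro z hz
    have h1 : ∀ᶠ w in 𝓝 z, χ w = 1 := (hχ1.filter_mono (nhds_le_nhdsSet hz))
    filter_upwards [h1.eventually_nhds, hU.mem_nhds (hKU hz)] with w hw hwU
    refine ⟨hwU, ?_⟩
    filter_upwards [hw] with x hx
    simp [hg, hx]
  have hgKd : ∀ z ∈ K, ∀ᶠ w in 𝓝 z, DifferentiableAt ℂ g w := by
    intro z hz
    filter_upwards [hgK z hz] with w hw
    exact (hh.differentiableAt (hU.mem_nhds hw.1)).congr_of_eventuallyEq hw.2
  have hpi : (2 * Real.pi * I : ℂ) ≠ 0 := two_pi_I_ne_zero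
  refine ⟨fun w => -(2 * Real.pi * I)⁻¹ * dbar g w, (continuous_dbar hgd).const_mul _, ?_, ?_, ?_⟩
  · refine HasCompactSupport.mul_left (f' := dbar g) ?_
    exact HasCompactSupport.of_support_subset_isCompact hgc (support_dbar_subset g)
  · intro z hz
    filter_upwards [hgKd z hz] with w hw
    simp [dbar_eq_zero hw]
  · intro z hz
    have hd : ∀ w, dbar (fun x => g (x + z)) w = dbar g (w + z) := by
      intro w
      simp [dbar, fderiv_comp_add_right]
    have hT : Tendsto (fun w : ℂ => w + z) (𝓝 0) (𝓝 z) := by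
      have : Continuous fun w : ℂ => w + z := by fun_prop
      simpa using this.tendsto 0
    have key := integral_inv_mul_dbar (g := fun x => g (x + z))
      (hgd.comp (contDiff_id.add contDiff_const))
      (hgc.comp_homeomorph (Homeomorph.addRight z))
      ((hT.eventually (hgKd z hz)).mono fun w hw =>
        DifferentiableAt.comp w hw (differentiableAt_id.add_const z))
    simp_rw [hd] at key
    have hshift := integral_add_right_eq_self (fun w : ℂ => (w - z)⁻¹ * dbar g w) z (μ := volume)
    simp only [add_sub_cancel_right] at hshift
    rw [hshift, zero_add, (hgK z hz).self_of_nhds.2.self_of_nhds] at key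
    have : ∀ w, -(2 * Real.pi * I : ℂ)⁻¹ * dbar g w * (w - z)⁻¹ =
      -(2 * Real.pi * I : ℂ)⁻¹ * ((w - z)⁻¹ * dbar g w) := fun w => by ring
    simp_rw [this]
    rw [integral_const_mul, key]
    field_simp

/-- Runge's theorem: if no component of the complement of the compact set `K` is bounded,
polynomials are uniformly dense on `K` among the functions holomorphic near `K`. -/
lemma exists_polynomial_norm_sub_lt {K U : Set ℂ} (hK : IsCompact K) (hU : IsOpen U)
    (hKU : K ⊆ U) (hcomp : ∀ z ∉ K, ¬ Bornology.IsBounded (connectedComponentIn Kᶜ z))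
    {h : ℂ → ℂ} (hh : DifferentiableOn ℂ h U) {ε : ℝ} (hε : 0 < ε) :
    ∃ p : Polynomial ℂ, ∀ z ∈ K, ‖p.eval z - h z‖ < ε := by
  have : CompactSpace K := isCompact_iff_compactSpace.1 hK
  obtain ⟨D, hDc, hDs, hD0, hD⟩ := exists_eq_integral_cauchy_kernel hK hU hKU hh
  set x : C(K, ℂ) := ⟨Subtype.val, continuous_subtype_val⟩ with hx
  set S : Subalgebra ℂ C(K, ℂ) := (Algebra.adjoin ℂ {x}).topologicalClosure with hS
  have hSc : IsClosed (S : Set C(K, ℂ)) := Subalgebra.isClosed_topologicalClosure _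
  have hxS : x ∈ S := Subalgebra.le_topologicalClosure _ (Algebra.subset_adjoin rfl)
  have hspec : spectrum ℂ x = K := by
    rw [ContinuousMap.spectrum_eq_range]
    simp [hx]
  -- the Cauchy kernels with poles off `K` lie in the closed algebra generated by polynomials
  have hres : ∀ w ∉ K, ∃ u ∈ S, ∀ z : K, u z = (w - z)⁻¹ := by
    intro w hw
    have h1 : w ∉ spectrum ℂ (⟨x, hxS⟩ : S) := by
      intro hmem
      refine hcomp w hw ?_
      have := Subalgebra.spectrum_isBounded_connectedComponentIn S (⟨x, hxS⟩ : S) hmem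
      simpa only [hspec] using this
    rw [spectrum.notMem_iff] at h1
    obtain ⟨u, hu⟩ := h1
    refine ⟨((u⁻¹ : Sˣ) : S), (((u⁻¹ : Sˣ) : S)).2, fun z => ?_⟩
    have h2 : ((u : S) : C(K, ℂ)) * (((u⁻¹ : Sˣ) : S) : C(K, ℂ)) = 1 :=
      congrArg (Subtype.val : S → C(K, ℂ)) u.mul_inv
    have h3 := congrArg (fun f : C(K, ℂ) => f z) h2
    rw [hu] at h3
    refine eq_inv_of_mul_eq_one_right ?_
    simpa [hx, Algebra.algebraMap_eq_smul_one] using h3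
  set Φ₀ : C(ℂ × K, ℂ) := ⟨fun q => D q.1 * (q.1 - q.2)⁻¹, by
    rw [continuous_iff_continuousAt]
    rintro ⟨w, z⟩
    by_cases hwz : w = z
    · refine ContinuousAt.congr (f := fun _ => (0 : ℂ)) continuousAt_const ?_
      have := (continuous_fst (X := ℂ) (Y := K)).continuousAt (x := (w, z))
      filter_upwards [this.eventually (hwz ▸ hD0 z z.2)] with q hq
      simp [hq]
    · refine ContinuousAt.mul (by fun_prop) (ContinuousAt.inv₀ (by fun_prop) ?_)
      exact sub_ne_zero.2 hwz⟩ with hΦ₀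
  set Φ : ℂ → C(K, ℂ) := fun w => Φ₀.curry w with hΦ
  have hΦc : Continuous Φ := Φ₀.curry.continuous
  have hΦa : ∀ w z, Φ w z = D w * (w - z)⁻¹ := fun w z => rfl
  have hΦS : ∀ w, Φ w ∈ S := by
    intro w
    by_cases hw : w ∈ K
    · have : Φ w = 0 := by
        ext z
        simp [hΦa, (hD0 w hw).self_of_nhds]
      rw [this]
      exact S.zero_mem
    · obtain ⟨u, huS, hu⟩ := hres w hw
      have : Φ w = D w • u := by
        ext z
        simp [hΦa, hu]
      rw [this]
      exact S.smul_mem huS _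
  have hΦs : HasCompactSupport Φ := by
    refine HasCompactSupport.of_support_subset_isCompact hDs fun w hw => subset_tsupport _ ?_
    intro h0
    apply hw
    ext z
    simp [hΦa, h0]
  have hΦi : Integrable Φ := hΦc.integrable_of_hasCompactSupport hΦs
  -- the integral can be formed inside the complete space `S`
  have hmem : ∫ w, Φ w ∈ S := by
    let T : Submodule ℝ C(K, ℂ) := S.toSubmodule.restrictScalars ℝ
    have hT : IsClosed (T : Set C(K, ℂ)) := hSc
    have : CompleteSpace T := hT.completeSpace_coe
    have h1 : Integrable fun w => (⟨Φ w, hΦS w⟩ : T) := by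
      refine (hΦc.subtype_mk _).integrable_of_hasCompactSupport ?_
      refine HasCompactSupport.of_support_subset_isCompact hΦs fun w hw => subset_tsupport _ ?_
      exact fun h0 => hw (Subtype.ext h0)
    have h2 := T.subtypeL.integral_comp_comm h1
    have h3 : ∫ w, Φ w = T.subtypeL (∫ w, (⟨Φ w, hΦS w⟩ : T)) := h2
    rw [h3]
    exact (∫ w, (⟨Φ w, hΦS w⟩ : T)).2
  have hmem' : ∫ w, Φ w ∈ closure (Algebra.adjoin ℂ {x} : Set C(K, ℂ)) := hmem
  obtain ⟨q, hq, hqd⟩ := Metric.mem_closure_iff.1 hmem' ε hε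
  rw [SetLike.mem_coe, Algebra.adjoin_singleton_eq_range_aeval] at hq
  obtain ⟨p, hp⟩ := hq
  refine ⟨p, fun z hz => ?_⟩
  have h1 : (∫ w, Φ w) ⟨z, hz⟩ = h z := by
    rw [ContinuousMap.integral_apply hΦi, hD z hz]
    rfl
  have h2 : q ⟨z, hz⟩ = p.eval z := by
    rw [← hp]
    exact Polynomial.aeval_continuousMap_apply p x ⟨z, hz⟩
  rw [← h1, ← h2, ← dist_eq_norm, dist_comm]
  exact (ContinuousMap.dist_apply_le_dist _).trans_lt hqd

end

/-! ### Primitives and square roots -/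

section

open Set Filter Topology MeasureTheory Metric Complex

lemma Polynomial.exists_hasDerivAt_eval (p : Polynomial ℂ) :
    ∃ q : Polynomial ℂ, ∀ z, HasDerivAt (fun z => q.eval z) (p.eval z) z := by
  induction p using Polynomial.induction_on' with
  | add p q hp hq =>
    obtain ⟨P, hP⟩ := hp
    obtain ⟨Q, hQ⟩ := hq
    refine ⟨P + Q, fun z => ?_⟩
    simpa using (hP z).fun_add (hQ z)
  | monomial n a =>
    refine ⟨Polynomial.monomial (n + 1) (a / (n + 1)), fun z => ?_⟩
    have h := (Polynomial.monomial (n + 1) (a / (n + 1 : ℂ))).hasDerivAt z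
    have hn : (n + 1 : ℂ) ≠ 0 := by exact_mod_cast n.succ_ne_zero
    rw [Polynomial.derivative_monomial] at h
    simpa [div_mul_cancel₀ _ hn] using h

/-- Polynomials approximate a holomorphic function locally uniformly on a bounded open set whose
complement has no bounded component. -/
lemma exists_tendstoLocallyUniformlyOn_polynomial {U : Set ℂ} (hU : IsOpen U)
    (hb : Bornology.IsBounded U)
    (hcomp : ∀ z ∉ U, ¬ Bornology.IsBounded (connectedComponentIn Uᶜ z))
    {h : ℂ → ℂ} (hh : DifferentiableOn ℂ h U) :
    ∃ p : ℕ → Polynomial ℂ,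
      TendstoLocallyUniformlyOn (fun n z => (p n).eval z) h atTop U := by
  set K : ℕ → Set ℂ := fun n => (thickening (1 / (n + 1 : ℝ)) Uᶜ)ᶜ with hKdef
  have hpos : ∀ n : ℕ, (0 : ℝ) < 1 / (n + 1) := fun n => Nat.one_div_pos_of_nat
  have hKU : ∀ n, K n ⊆ U := fun n =>
    compl_subset_comm.1 (self_subset_thickening (hpos n) _)
  have hKc : ∀ n, IsCompact (K n) := fun n =>
    Metric.isCompact_of_isClosed_isBounded isOpen_thickening.isClosed_compl (hb.subset (hKU n))
  -- every component of the complement of `K n` swallows a component of the complement of `U`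
  have hKcomp : ∀ n, ∀ z ∉ K n, ¬ Bornology.IsBounded (connectedComponentIn (K n)ᶜ z) := by
    intro n z hz hbd
    have hz' : z ∈ thickening (1 / (n + 1 : ℝ)) Uᶜ := by simpa [hKdef] using hz
    obtain ⟨y, hyU, hzy⟩ := mem_thickening_iff.1 hz'
    have hball : ball y (1 / (n + 1 : ℝ)) ⊆ (K n)ᶜ := by
      intro x hx
      simp only [hKdef, compl_compl]
      exact mem_thickening_iff.2 ⟨y, hyU, hx⟩
    have hsub : connectedComponentIn Uᶜ y ⊆ (K n)ᶜ :=
      (connectedComponentIn_subset _ _).trans (compl_subset_compl.2 (hKU n))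
    have hconn : IsPreconnected (ball y (1 / (n + 1 : ℝ)) ∪ connectedComponentIn Uᶜ y) :=
      IsPreconnected.union y (mem_ball_self (hpos n)) (mem_connectedComponentIn hyU)
        (convex_ball _ _).isPreconnected isPreconnected_connectedComponentIn
    refine hcomp y hyU (hbd.subset ?_)
    exact subset_union_right.trans
      (hconn.subset_connectedComponentIn (Or.inl hzy) (union_subset hball hsub))
  choose p hp using fun n => exists_polynomial_norm_sub_lt (hKc n) hU (hKU n) (hKcomp n) hh (hpos n)
  refine ⟨p, ?_⟩
  rw [Metric.tendstoLocallyUniformlyOn_iff]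
  intro ε hε x hx
  obtain ⟨ρ, hρ, hρU⟩ := Metric.isOpen_iff.1 hU x hx
  refine ⟨ball x (ρ / 2), mem_nhdsWithin_of_mem_nhds (ball_mem_nhds _ (half_pos hρ)), ?_⟩
  have hlim : Tendsto (fun n : ℕ => 1 / ((n : ℝ) + 1)) atTop (𝓝 0) :=
    tendsto_one_div_add_atTop_nhds_zero_nat
  filter_upwards [hlim.eventually_lt_const (half_pos hρ), hlim.eventually_lt_const hε]
    with n hn1 hn2 y hy
  have hyK : y ∈ K n := by
    intro hmem
    obtain ⟨w, hwU, hyw⟩ := mem_thickening_iff.1 hmem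
    refine hwU (hρU ?_)
    rw [mem_ball] at hy ⊢
    linarith [dist_triangle_left w x y]
  rw [dist_comm, dist_eq_norm]
  exact (hp n y hyK).trans hn2

/-- A holomorphic function on a bounded connected open set whose complement has no bounded
component has a primitive. -/
lemma exists_primitive {U : Set ℂ} (hU : IsOpen U) (hUc : IsPreconnected U)
    (hb : Bornology.IsBounded U)
    (hcomp : ∀ z ∉ U, ¬ Bornology.IsBounded (connectedComponentIn Uᶜ z))
    {h : ℂ → ℂ} (hh : DifferentiableOn ℂ h U) :
    ∃ H : ℂ → ℂ, ∀ z ∈ U, HasDerivAt H (h z) z := by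
  rcases U.eq_empty_or_nonempty with rfl | ⟨z₀, hz₀⟩
  · exact ⟨0, by simp⟩
  obtain ⟨p, hp⟩ := exists_tendstoLocallyUniformlyOn_polynomial hU hb hcomp hh
  choose q hq using fun n => (p n).exists_hasDerivAt_eval
  set Q : ℕ → ℂ → ℂ := fun n z => (q n).eval z - (q n).eval z₀ with hQ
  have hQd : ∀ n z, HasDerivAt (Q n) ((p n).eval z) z := fun n z => (hq n z).sub_const _
  have hloc : ∀ x ∈ U, ∃ ρ > 0, ball x ρ ⊆ U ∧
      UniformCauchySeqOn (fun n z => (p n).eval z) atTop (ball x ρ) := by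
    intro x hx
    obtain ⟨ρ, hρ, hρU⟩ := Metric.nhds_basis_closedBall.mem_iff.1 (hU.mem_nhds hx)
    have htc := (tendstoLocallyUniformlyOn_iff_forall_isCompact hU).1 hp _ hρU
      (isCompact_closedBall x ρ)
    exact ⟨ρ, hρ, ball_subset_closedBall.trans hρU,
      (htc.mono ball_subset_closedBall).uniformCauchySeqOn⟩
  -- the set of convergence is clopen in `U`
  set C : Set ℂ := {z | Cauchy (map (fun n => Q n z) atTop)} with hC
  have hprop : ∀ x ρ, UniformCauchySeqOn (fun n z => (p n).eval z) atTop (ball x ρ) →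
      ∀ y ∈ ball x ρ, y ∈ C → ∀ w ∈ ball x ρ, w ∈ C := by
    intro x ρ hu y hy hyC w hw
    have hu' : UniformCauchySeqOn
        (fun n z => (1 : ℂ →L[ℂ] ℂ).smulRight ((p n).eval z)) atTop (ball x ρ) := by
      rw [uniformCauchySeqOn_iff_uniformCauchySeqOnFilter] at hu ⊢
      exact hu.one_smulRight
    exact cauchy_map_of_uniformCauchySeqOn_fderiv (𝕜 := ℂ) isOpen_ball
      (convex_ball x ρ).isPreconnected hu'
      (fun n z _ => (hQd n z).hasFDerivAt) hy hw hyC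
  have hCU : U ⊆ C := by
    have hz₀C : z₀ ∈ C := by
      have : Tendsto (fun n => Q n z₀) atTop (𝓝 0) := by simp [hQ]
      exact this.cauchy_map
    have hI : U ⊆ interior C := by
      refine hUc.subset_of_closure_inter_subset isOpen_interior ⟨z₀, hz₀, ?_⟩ ?_
      · obtain ⟨ρ, hρ, -, hu⟩ := hloc z₀ hz₀
        exact mem_interior.2 ⟨ball z₀ ρ, fun w hw => hprop z₀ ρ hu z₀ (mem_ball_self hρ) hz₀C w hw,
          isOpen_ball, mem_ball_self hρ⟩
      · rintro x ⟨hxc, hxU⟩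
        obtain ⟨ρ, hρ, -, hu⟩ := hloc x hxU
        obtain ⟨y, hyC, hy⟩ := Metric.mem_closure_iff.1 hxc ρ hρ
        exact mem_interior.2 ⟨ball x ρ, fun w hw => hprop x ρ hu y (mem_ball'.2 hy)
          (interior_subset hyC) w hw, isOpen_ball, mem_ball_self hρ⟩
    exact hI.trans interior_subset
  choose! H hH using fun z (hz : z ∈ U) => cauchy_map_iff_exists_tendsto.1 (hCU hz)
  refine ⟨H, fun z hz => ?_⟩
  exact hasDerivAt_of_tendstoLocallyUniformlyOn hU hp
    (Eventually.of_forall fun n x _ => hQd n x) hH hz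

/-- On a bounded connected open set whose complement has no bounded component, a zero-free
holomorphic function has a holomorphic square root. -/
lemma exists_sqrt {U : Set ℂ} (hU : IsOpen U) (hUc : IsPreconnected U)
    (hb : Bornology.IsBounded U)
    (hcomp : ∀ z ∉ U, ¬ Bornology.IsBounded (connectedComponentIn Uᶜ z))
    {f : ℂ → ℂ} (hf : DifferentiableOn ℂ f U) (hf0 : ∀ z ∈ U, f z ≠ 0) :
    ∃ g : ℂ → ℂ, DifferentiableOn ℂ g U ∧ ∀ z ∈ U, g z ^ 2 = f z := by
  rcases U.eq_empty_or_nonempty with rfl | ⟨z₀, hz₀⟩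
  · exact ⟨0, by simp, by simp⟩
  have hf' : DifferentiableOn ℂ (fun z => deriv f z / f z) U := (hf.deriv hU).div hf hf0
  obtain ⟨H, hH⟩ := exists_primitive hU hUc hb hcomp hf'
  -- `H` is a branch of `log f` up to a constant
  have hconst : ∀ z ∈ U, f z * exp (-H z) = f z₀ * exp (-H z₀) := by
    have hd : ∀ z ∈ U, HasDerivAt (fun z => f z * exp (-H z)) 0 z := by
      intro z hz
      have h1 := (hf.differentiableAt (hU.mem_nhds hz)).hasDerivAt.mul (hH z hz).neg.cexp
      refine h1.congr_deriv ?_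
      field_simp [hf0 z hz]
      ring
    intro z hz
    refine hU.is_const_of_deriv_eq_zero hUc (f := fun z => f z * exp (-H z))
      (fun z hz => (hd z hz).differentiableAt.differentiableWithinAt)
      (fun z hz => (hd z hz).deriv) hz hz₀
  obtain ⟨c, hc⟩ : ∃ c, exp c = f z₀ * exp (-H z₀) :=
    ⟨_, exp_log (mul_ne_zero (hf0 z₀ hz₀) (exp_ne_zero _))⟩
  refine ⟨fun z => exp ((H z + c) / 2), fun z hz => ?_, fun z hz => ?_⟩
  · exact (((hH z hz).add_const c).div_const 2).cexp.differentiableAt.differentiableWithinAt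
  · rw [← exp_nat_mul, Nat.cast_ofNat, mul_div_cancel₀ _ two_ne_zero, exp_add, hc, ← hconst z hz,
      mul_left_comm, ← exp_add, add_neg_cancel, exp_zero, mul_one]

end

/-! ### The Riemann mapping theorem -/

section

open Set Filter Topology MeasureTheory Metric Complex

/-- Montel's theorem along an ultrafilter: pointwise limits exist by compactness of the closed
disk, and Schwarz's lemma provides the equicontinuity that makes the convergence locally uniform. -/
lemma exists_tendstoLocallyUniformlyOn_ultrafilter {ι : Type*} (φ : Ultrafilter ι) {U : Set ℂ}
    (hU : IsOpen U) {f : ι → ℂ → ℂ} (hf : ∀ i, DifferentiableOn ℂ (f i) U)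
    (hf1 : ∀ i, MapsTo (f i) U (closedBall 0 1)) :
    ∃ g : ℂ → ℂ, TendstoLocallyUniformlyOn f g φ U := by
  have hlim : ∀ z ∈ U, ∃ y, Tendsto (fun i => f i z) φ (𝓝 y) := by
    intro z hz
    obtain ⟨y, -, hy⟩ := (isCompact_closedBall (0 : ℂ) 1).ultrafilter_le_nhds
      (φ.map fun i => f i z) (le_principal_iff.2
        (Filter.Eventually.of_forall (f := (φ : Filter ι)) fun i => hf1 i hz))
    exact ⟨y, hy⟩
  choose! g hg using hlim
  refine ⟨g, ?_⟩
  rw [Metric.tendstoLocallyUniformlyOn_iff]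
  intro ε hε x hx
  obtain ⟨ρ, hρ, hρU⟩ := Metric.isOpen_iff.1 hU x hx
  have hlip : ∀ i, ∀ z ∈ ball x ρ, dist (f i z) (f i x) ≤ 2 / ρ * dist z x := by
    intro i z hz
    refine dist_le_div_mul_dist_of_mapsTo_ball ((hf i).mono hρU) (fun y hy => ?_) hz
    have h1 := hf1 i (hρU hy)
    have h2 := hf1 i hx
    rw [mem_closedBall] at h1 h2 ⊢
    linarith [dist_triangle_right (f i y) (f i x) 0]
  obtain ⟨η, hη, hηρ, hηε⟩ : ∃ η > 0, η ≤ ρ ∧ 2 / ρ * η ≤ ε / 4 := by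
    refine ⟨min ρ (ρ * ε / 8), by positivity, min_le_left _ _, ?_⟩
    calc 2 / ρ * min ρ (ρ * ε / 8) ≤ 2 / ρ * (ρ * ε / 8) := by
          gcongr
          exact min_le_right _ _
      _ = ε / 4 := by field_simp; ring
  have hlip' : ∀ i, ∀ z ∈ ball x η, dist (f i z) (f i x) ≤ ε / 4 := by
    intro i z hz
    refine (hlip i z (ball_subset_ball hηρ hz)).trans (le_trans ?_ hηε)
    have : dist z x ≤ η := (mem_ball.1 hz).le
    gcongr
  refine ⟨ball x η, mem_nhdsWithin_of_mem_nhds (ball_mem_nhds _ hη), ?_⟩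
  filter_upwards [(tendsto_iff_dist_tendsto_zero.1 (hg x hx)).eventually_lt_const
    (show 0 < ε / 4 by positivity)] with i hi z hz
  have hzU : z ∈ U := hρU (ball_subset_ball hηρ hz)
  have h3 : dist (g z) (g x) ≤ ε / 4 :=
    le_of_tendsto ((hg z hzU).dist (hg x hx)) (Eventually.of_forall fun i => hlip' i z hz)
  have h4 := hlip' i z hz
  have h5 := dist_triangle4 (g z) (g x) (f i x) (f i z)
  rw [dist_comm (g x) (f i x), dist_comm (f i x) (f i z)] at h5
  linarith

/-- Hurwitz's theorem: a nonconstant locally uniform limit of injective holomorphic functions is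
injective. -/
lemma injOn_of_tendstoLocallyUniformlyOn {ι : Type*} {φ : Filter ι} [φ.NeBot] {U : Set ℂ}
    (hU : IsOpen U) (hUc : IsPreconnected U) {f : ι → ℂ → ℂ} {g : ℂ → ℂ}
    (hf : ∀ i, DifferentiableOn ℂ (f i) U) (hinj : ∀ i, InjOn (f i) U)
    (hfg : TendstoLocallyUniformlyOn f g φ U) {z₀ : ℂ} (hz₀ : z₀ ∈ U) (hd : deriv g z₀ ≠ 0) :
    InjOn g U := by
  have hg : DifferentiableOn ℂ g U := hfg.differentiableOn (Eventually.of_forall hf) hU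
  intro a ha b hb hab
  by_contra hne
  have hG : AnalyticOnNhd ℂ (fun z => g z - g a) U := (hg.sub_const _).analyticOnNhd hU
  -- `b` is an isolated zero of `g - g a`
  have hiso : ∀ᶠ z in 𝓝[≠] b, g z - g a ≠ 0 := by
    by_contra hcon
    have hfreq : ∃ᶠ z in 𝓝[≠] b, g z - g a = 0 :=
      (not_eventually.1 hcon).mono fun z hz => not_not.1 hz
    have h0 := hG.eqOn_zero_of_preconnected_of_frequently_eq_zero hUc hb hfreq
    apply hd
    have h1 : g =ᶠ[𝓝 z₀] fun _ => g a := by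
      filter_upwards [hU.mem_nhds hz₀] with z hz
      exact sub_eq_zero.1 (h0 hz)
    rw [h1.deriv_eq, deriv_const]
  obtain ⟨r₁, hr₁, hr₁'⟩ := Metric.nhds_basis_closedBall.mem_iff.1
    (inter_mem (hU.mem_nhds hb) (eventually_nhdsWithin_iff.1 hiso))
  obtain ⟨r, hr, hrr₁, hra⟩ : ∃ r > 0, r ≤ r₁ ∧ r < dist a b := by
    have : 0 < dist a b := dist_pos.2 hne
    exact ⟨min r₁ (dist a b / 2), by positivity, min_le_left _ _,
      (min_le_right _ _).trans_lt (by linarith)⟩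
  have hrU : closedBall b r ⊆ U := fun z hz => (hr₁' (closedBall_subset_closedBall hrr₁ hz)).1
  have hsne : (sphere b r).Nonempty := NormedSpace.sphere_nonempty.2 hr.le
  obtain ⟨x, hx, hmin⟩ := (isCompact_sphere b r).exists_isMinOn hsne
    (f := fun z => ‖g z - g a‖)
    ((hG.continuousOn.mono (sphere_subset_closedBall.trans hrU)).norm)
  set m := ‖g x - g a‖ with hm
  have hm0 : 0 < m := by
    refine norm_pos_iff.2 ((hr₁' (closedBall_subset_closedBall hrr₁
      (sphere_subset_closedBall hx))).2 ?_)
    rintro rfl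
    simp at hx
    exact hr.ne' hx.symm
  have hunif := (tendstoLocallyUniformlyOn_iff_forall_isCompact hU).1 hfg (insert a (closedBall b r))
    (insert_subset ha hrU) ((isCompact_closedBall b r).insert a)
  obtain ⟨i, hi⟩ := (Metric.tendstoUniformlyOn_iff.1 hunif (m / 5) (by positivity)).exists
  have hia : dist (g a) (f i a) < m / 5 := hi a (mem_insert _ _)
  have hi' : ∀ z ∈ closedBall b r, dist (g z) (f i z) < m / 5 := fun z hz =>
    hi z (mem_insert_of_mem _ hz)
  -- for this `i`, the zero-free function `f i - f i a` has modulus at least `3 * m / 5` on the sphere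
  -- but less than `2 * m / 5` at the centre, against the maximum principle for its inverse
  have hne0 : ∀ z ∈ closedBall b r, f i z - f i a ≠ 0 := by
    intro z hz h0
    have := hinj i (hrU hz) ha (sub_eq_zero.1 h0)
    rw [this] at hz
    exact absurd (mem_closedBall.1 hz) (not_le.2 hra)
  have hdc : DiffContOnCl ℂ (fun z => (f i z - f i a)⁻¹) (ball b r) := by
    refine DifferentiableOn.diffContOnCl ?_
    rw [closure_ball _ hr.ne']
    exact (((hf i).mono hrU).sub_const _).inv hne0
  have hmax := norm_le_of_forall_mem_frontier_norm_le (C := (3 * m / 5)⁻¹) isBounded_ball hdc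
    (by
      intro z hz
      rw [frontier_ball _ hr.ne'] at hz
      rw [norm_inv]
      have h1 : m ≤ ‖g z - g a‖ := hmin hz
      have h2 := hi' z (sphere_subset_closedBall hz)
      rw [dist_eq_norm] at h2 hia
      have h3 : ‖g z - g a‖ ≤ ‖g z - f i z‖ + ‖f i z - f i a‖ + ‖g a - f i a‖ := by
        calc ‖g z - g a‖ = ‖(g z - f i z) + (f i z - f i a) - (g a - f i a)‖ := by ring_nf
          _ ≤ ‖(g z - f i z) + (f i z - f i a)‖ + ‖g a - f i a‖ := norm_sub_le _ _
          _ ≤ _ := by gcongr; exact norm_add_le _ _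
      exact inv_anti₀ (by positivity) (by linarith))
    (z := b) (subset_closure (mem_ball_self hr))
  rw [norm_inv, inv_le_inv₀ (norm_pos_iff.2 (hne0 b (mem_closedBall_self hr.le)))
    (by positivity)] at hmax
  have h4 := hi' b (mem_closedBall_self hr.le)
  have h5 : ‖f i b - f i a‖ ≤ dist (g b) (f i b) + dist (g a) (f i a) := by
    rw [← dist_eq_norm, ← hab, dist_comm (g a) (f i b)]
    exact dist_triangle _ _ _
  linarith

/-- The disk automorphism `z ↦ (z - a) / (1 - ā z)`. -/
noncomputable def diskAut (a z : ℂ) : ℂ := (z - a) / (1 - starRingEnd ℂ a * z)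

lemma one_sub_conj_mul_ne_zero {a z : ℂ} (ha : ‖a‖ < 1) (hz : ‖z‖ < 1) :
    1 - starRingEnd ℂ a * z ≠ 0 := by
  intro h
  have h1 : ‖starRingEnd ℂ a * z‖ = 1 := by
    rw [← sub_eq_zero.1 h, norm_one]
  rw [norm_mul, RCLike.norm_conj] at h1
  nlinarith [norm_nonneg a, norm_nonneg z]

lemma norm_diskAut_lt_one {a z : ℂ} (ha : ‖a‖ < 1) (hz : ‖z‖ < 1) : ‖diskAut a z‖ < 1 := by
  have h0 := one_sub_conj_mul_ne_zero ha hz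
  rw [diskAut, norm_div, div_lt_one (norm_pos_iff.2 h0)]
  refine lt_of_pow_lt_pow_left₀ 2 (norm_nonneg _) ?_
  have h1 : ‖1 - starRingEnd ℂ a * z‖ ^ 2 - ‖z - a‖ ^ 2 = (1 - ‖a‖ ^ 2) * (1 - ‖z‖ ^ 2) := by
    simp only [← normSq_eq_norm_sq, normSq_apply, sub_re, sub_im, one_re, one_im, mul_re, mul_im,
      conj_re, conj_im]
    ring
  have h2 : 0 < (1 - ‖a‖ ^ 2) * (1 - ‖z‖ ^ 2) := by
    apply mul_pos <;> nlinarith [norm_nonneg a, norm_nonneg z]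
  linarith

lemma diskAut_injOn {a : ℂ} (ha : ‖a‖ < 1) : InjOn (diskAut a) (ball 0 1) := by
  intro z hz w hw h
  rw [mem_ball_zero_iff] at hz hw
  rw [diskAut, diskAut, div_eq_div_iff (one_sub_conj_mul_ne_zero ha hz)
    (one_sub_conj_mul_ne_zero ha hw)] at h
  have h1 : (1 - starRingEnd ℂ a * a) * (z - w) = 0 := by linear_combination h
  exact sub_eq_zero.1 ((mul_eq_zero.1 h1).resolve_left (one_sub_conj_mul_ne_zero ha ha))

lemma hasDerivAt_diskAut {a z : ℂ} (ha : ‖a‖ < 1) (hz : ‖z‖ < 1) :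
    HasDerivAt (diskAut a)
      ((1 - starRingEnd ℂ a * a) / (1 - starRingEnd ℂ a * z) ^ 2) z := by
  have h := ((hasDerivAt_id z).sub_const a).div
    (((hasDerivAt_id z).const_mul (starRingEnd ℂ a)).const_sub 1) (one_sub_conj_mul_ne_zero ha hz)
  refine h.congr_deriv ?_
  simp only [id]
  ring

/-- The injective holomorphic maps of `U` into the unit disk that send `z₀` to the centre. -/
def diskMaps (U : Set ℂ) (z₀ : ℂ) : Set (ℂ → ℂ) :=
  {f | DifferentiableOn ℂ f U ∧ InjOn f U ∧ MapsTo f U (ball 0 1) ∧ f z₀ = 0}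

/-- Koebe's square root trick: a map into the disk that omits a value is not extremal. -/
lemma exists_diskMaps_norm_deriv_lt {U : Set ℂ} (hU : IsOpen U)
    (hsqrt : ∀ p : ℂ → ℂ, DifferentiableOn ℂ p U → (∀ z ∈ U, p z ≠ 0) →
      ∃ g : ℂ → ℂ, DifferentiableOn ℂ g U ∧ ∀ z ∈ U, g z ^ 2 = p z)
    {z₀ : ℂ} (hz₀ : z₀ ∈ U) {f : ℂ → ℂ} (hf : f ∈ diskMaps U z₀) (hd : deriv f z₀ ≠ 0)
    {w : ℂ} (hw : ‖w‖ < 1) (hwf : w ∉ f '' U) :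
    ∃ G ∈ diskMaps U z₀, ‖deriv f z₀‖ < ‖deriv G z₀‖ := by
  obtain ⟨hfd, hfi, hfm, hf0⟩ := hf
  have hfn : ∀ z ∈ U, ‖f z‖ < 1 := fun z hz => by simpa using hfm hz
  have hpd : DifferentiableOn ℂ (fun z => diskAut w (f z)) U := fun z hz =>
    (hasDerivAt_diskAut hw (hfn z hz)).differentiableAt.comp_differentiableWithinAt z (hfd z hz)
  have hp0 : ∀ z ∈ U, diskAut w (f z) ≠ 0 := by
    intro z hz h0
    rw [diskAut, div_eq_zero_iff, sub_eq_zero] at h0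
    rcases h0 with h0 | h0
    · exact hwf ⟨z, hz, h0⟩
    · exact one_sub_conj_mul_ne_zero hw (hfn z hz) h0
  obtain ⟨g, hgd, hg⟩ := hsqrt _ hpd hp0
  have hgn : ∀ z ∈ U, ‖g z‖ < 1 := by
    intro z hz
    have h1 := norm_diskAut_lt_one hw (hfn z hz)
    rw [← hg z hz, norm_pow] at h1
    nlinarith [norm_nonneg (g z)]
  set b := g z₀ with hb
  have hb1 : ‖b‖ < 1 := hgn z₀ hz₀
  have hb2 : b ^ 2 = -w := by
    rw [hb, hg z₀ hz₀, hf0]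
    simp [diskAut]
  have hb0 : b ≠ 0 := by
    intro h0
    apply hp0 z₀ hz₀
    rw [← hg z₀ hz₀, ← hb, h0]
    simp
  refine ⟨fun z => diskAut b (g z), ⟨fun z hz => ?_, ?_, fun z hz => ?_, ?_⟩, ?_⟩
  · exact (hasDerivAt_diskAut hb1 (hgn z hz)).differentiableAt.comp_differentiableWithinAt z
      (hgd z hz)
  · intro x hx y hy hxy
    have h1 : g x = g y := diskAut_injOn hb1 (by simpa using hgn x hx) (by simpa using hgn y hy) hxy
    have h2 : diskAut w (f x) = diskAut w (f y) := by rw [← hg x hx, ← hg y hy, h1]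
    exact hfi hx hy (diskAut_injOn hw (hfm hx) (hfm hy) h2)
  · simpa using norm_diskAut_lt_one hb1 (hgn z hz)
  · simp [diskAut, ← hb]
  have hf' := (hfd.differentiableAt (hU.mem_nhds hz₀)).hasDerivAt
  have hg' := (hgd.differentiableAt (hU.mem_nhds hz₀)).hasDerivAt
  have hG' : deriv (fun z => diskAut b (g z)) z₀ = (1 - starRingEnd ℂ b * b)⁻¹ * deriv g z₀ := by
    have h1 := (hasDerivAt_diskAut hb1 hb1).comp z₀ hg'
    rw [show (fun z => diskAut b (g z)) = diskAut b ∘ g from rfl, h1.deriv]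
    have := one_sub_conj_mul_ne_zero hb1 hb1
    field_simp
  have hp' : 2 * b * deriv g z₀ = (1 - starRingEnd ℂ w * w) * deriv f z₀ := by
    have h1 : HasDerivAt (fun z => g z ^ 2) (2 * b * deriv g z₀) z₀ := by
      simpa using hg'.fun_pow 2
    have h2 := (hasDerivAt_diskAut hw (hfn z₀ hz₀)).comp z₀ hf'
    have h3 : (fun z => g z ^ 2) =ᶠ[𝓝 z₀] diskAut w ∘ f := by
      filter_upwards [hU.mem_nhds hz₀] with z hz
      exact hg z hz
    have h4 := h1.unique (h2.congr_of_eventuallyEq h3)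
    simpa [hf0] using h4
  have hconj : ∀ c : ℂ, ‖c‖ < 1 → ‖1 - starRingEnd ℂ c * c‖ = 1 - ‖c‖ ^ 2 := by
    intro c hc
    rw [← normSq_eq_conj_mul_self, normSq_eq_norm_sq, ← ofReal_one, ← ofReal_sub, norm_real,
      Real.norm_of_nonneg]
    nlinarith [norm_nonneg c]
  have hnw : ‖w‖ = ‖b‖ ^ 2 := by rw [← norm_pow, hb2, norm_neg]
  have hnp := congrArg norm hp'
  rw [norm_mul, norm_mul, norm_mul, hconj w hw, Complex.norm_ofNat, hnw] at hnp
  rw [hG', norm_mul, norm_inv, hconj b hb1]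
  have hbp : 0 < ‖b‖ := norm_pos_iff.2 hb0
  have h1b : 0 < 1 - ‖b‖ ^ 2 := by nlinarith
  have hfp : 0 < ‖deriv f z₀‖ := norm_pos_iff.2 hd
  rw [← div_eq_inv_mul, lt_div_iff₀ h1b]
  -- `2 |b| < 1 + |b|²`
  have key : 2 * ‖b‖ * (‖deriv f z₀‖ * (1 - ‖b‖ ^ 2)) < 2 * ‖b‖ * ‖deriv g z₀‖ := by
    rw [hnp]
    have h2 : 0 < (1 - ‖b‖) ^ 2 := by
      have : 0 < 1 - ‖b‖ := by linarith
      positivity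
    have h3 : 0 < (1 - ‖b‖) ^ 2 * ((1 - ‖b‖ ^ 2) * ‖deriv f z₀‖) := by positivity
    nlinarith
  exact lt_of_mul_lt_mul_left key (by positivity)

/-- The Riemann mapping theorem for bounded domains on which zero-free holomorphic functions have
square roots. -/
theorem nonempty_homeomorph_ball_of_sqrt {U : Set ℂ} (hU : IsOpen U) (hUc : IsConnected U)
    (hb : Bornology.IsBounded U)
    (hsqrt : ∀ p : ℂ → ℂ, DifferentiableOn ℂ p U → (∀ z ∈ U, p z ≠ 0) →
      ∃ g : ℂ → ℂ, DifferentiableOn ℂ g U ∧ ∀ z ∈ U, g z ^ 2 = p z) :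
    Nonempty (U ≃ₜ ball (0 : ℂ) 1) := by
  obtain ⟨z₀, hz₀⟩ := hUc.nonempty
  obtain ⟨ρ, hρ, hρU⟩ := Metric.isOpen_iff.1 hU z₀ hz₀
  set s : Set ℝ := (fun f : ℂ → ℂ => ‖deriv f z₀‖) '' diskMaps U z₀ with hs
  have hsb : BddAbove s := by
    refine ⟨1 / ρ, ?_⟩
    rintro _ ⟨f, ⟨hfd, -, hfm, hf0⟩, rfl⟩
    refine norm_deriv_le_div_of_mapsTo_ball (hfd.mono hρU) (fun z hz => ?_) hρ
    rw [hf0]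
    exact ball_subset_closedBall (hfm (hρU hz))
  obtain ⟨R, hR, hUR⟩ : ∃ R > 0, U ⊆ ball z₀ R := by
    obtain ⟨R, hR⟩ := hb.subset_ball z₀
    exact ⟨max R 1, by positivity, hR.trans (ball_subset_ball (le_max_left _ _))⟩
  have hRs : R⁻¹ ∈ s := by
    have hder : ∀ z, HasDerivAt (fun z : ℂ => (R : ℂ)⁻¹ * (z - z₀)) (R : ℂ)⁻¹ z := fun z => by
      simpa using ((hasDerivAt_id z).sub_const z₀).const_mul (R : ℂ)⁻¹
    have hR0 : (R : ℂ)⁻¹ ≠ 0 := by simpa using hR.ne'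
    refine ⟨fun z => (R : ℂ)⁻¹ * (z - z₀),
      ⟨fun z _ => (hder z).differentiableAt.differentiableWithinAt, fun x _ y _ hxy => ?_, fun z hz => ?_, by simp⟩, ?_⟩
    · simpa [hR0, hR.ne'] using hxy
    · have := hUR hz
      rw [mem_ball, dist_eq_norm] at this
      rw [mem_ball_zero_iff, norm_mul, norm_inv, norm_real, Real.norm_of_nonneg hR.le,
        inv_mul_lt_iff₀ hR, mul_one]
      exact this
    · simp [(hder z₀).deriv, abs_of_pos hR]
  have hspos : 0 < sSup s := (inv_pos.2 hR).trans_le (le_csSup hsb hRs)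
  obtain ⟨u, -, hu, hus⟩ := exists_seq_tendsto_sSup ⟨_, hRs⟩ hsb
  choose f hf hfu using hus
  obtain ⟨g, hg⟩ := exists_tendstoLocallyUniformlyOn_ultrafilter (hyperfilter ℕ) hU
    (fun n => (hf n).1) (fun n => (hf n).2.2.1.mono_right ball_subset_closedBall)
  have hφ : ((hyperfilter ℕ : Ultrafilter ℕ) : Filter ℕ) ≤ atTop := Nat.hyperfilter_le_atTop
  have hfd : ∀ᶠ n in (hyperfilter ℕ : Filter ℕ), DifferentiableOn ℂ (f n) U :=
    Eventually.of_forall fun n => (hf n).1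
  have hgd : DifferentiableOn ℂ g U := hg.differentiableOn hfd hU
  have hgderiv : ‖deriv g z₀‖ = sSup s := by
    have h1 := ((hg.deriv hfd hU).tendsto_at hz₀).norm
    refine tendsto_nhds_unique h1 ((hu.mono_left hφ).congr fun n => ?_)
    exact (hfu n).symm
  have hg0 : deriv g z₀ ≠ 0 := by
    rw [← norm_pos_iff, hgderiv]
    exact hspos
  have hgi : InjOn g U := injOn_of_tendstoLocallyUniformlyOn hU hUc.isPreconnected
    (fun n => (hf n).1) (fun n => (hf n).2.1) hg hz₀ hg0
  have hopen : ∀ t ⊆ U, IsOpen t → IsOpen (g '' t) := by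
    refine ((hgd.analyticOnNhd hU).is_constant_or_isOpen hUc.isPreconnected).resolve_left ?_
    rintro ⟨w, hw⟩
    apply hg0
    have h1 : g =ᶠ[𝓝 z₀] fun _ => w := by
      filter_upwards [hU.mem_nhds hz₀] with z hz
      exact hw z hz
    rw [h1.deriv_eq, deriv_const]
  have hgm : MapsTo g U (ball 0 1) := by
    rw [mapsTo_iff_image_subset, ← interior_closedBall (0 : ℂ) one_ne_zero]
    refine interior_maximal ?_ (hopen U subset_rfl hU)
    rintro _ ⟨z, hz, rfl⟩
    exact isClosed_closedBall.mem_of_tendsto (hg.tendsto_at hz)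
      (Eventually.of_forall fun n => ball_subset_closedBall ((hf n).2.2.1 hz))
  have hgz : g z₀ = 0 := by
    refine tendsto_nhds_unique (hg.tendsto_at hz₀) ?_
    simp [(hf _).2.2.2]
  have hgF : g ∈ diskMaps U z₀ := ⟨hgd, hgi, hgm, hgz⟩
  have hsurj : g '' U = ball 0 1 := by
    refine hgm.image_subset.antisymm fun w hw => ?_
    by_contra hwg
    obtain ⟨G, hG, hlt⟩ := exists_diskMaps_norm_deriv_lt hU hsqrt hz₀ hgF hg0
      (by simpa using hw) hwg
    have := le_csSup hsb ⟨G, hG, rfl⟩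
    rw [← hgderiv] at this
    exact absurd hlt (not_lt.2 this)
  have hemb : IsOpenEmbedding (U.domRestrict g) := by
    refine .of_continuous_injective_isOpenMap hgd.continuousOn.domRestrict
      (injOn_iff_injective.1 hgi) fun t ht => ?_
    have h1 : U.domRestrict g '' t = g '' (Subtype.val '' t) := by
      rw [image_image]
      rfl
    rw [h1]
    exact hopen _ (Subtype.coe_image_subset _ _) (hU.isOpenMap_subtype_val t ht)
  refine ⟨hemb.isEmbedding.toHomeomorph.trans (Homeomorph.setCongr ?_)⟩
  rw [range_domRestrict, hsurj]

/-- A bounded connected open subset of `ℂ` is a topological disk if its complement has no bounded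
component. -/
theorem nonempty_homeomorph_ball_of_compl {U : Set ℂ} (hU : IsOpen U) (hUc : IsConnected U)
    (hb : Bornology.IsBounded U)
    (hcomp : ∀ z ∉ U, ¬ Bornology.IsBounded (connectedComponentIn Uᶜ z)) :
    Nonempty (U ≃ₜ ball (0 : ℂ) 1) :=
  nonempty_homeomorph_ball_of_sqrt hU hUc hb fun _ hp hp0 =>
    exists_sqrt hU hUc.isPreconnected hb hcomp hp hp0

end

/-! ### Infields -/

section

open Set Filter Topology MeasureTheory Metric

namespace QuasiPattern

lemma isBounded_image_iff_of_isometry {X Y : Type*} [PseudoMetricSpace X] [PseudoMetricSpace Y]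
    {f : X → Y} (hf : Isometry f) {A : Set X} :
    Bornology.IsBounded (f '' A) ↔ Bornology.IsBounded A := by
  refine ⟨fun h => ?_, fun h => hf.lipschitz.isBounded_image h⟩
  exact (hf.antilipschitz.isBounded_preimage h).subset (subset_preimage_image f A)

lemma isClosed_connectedComponentIn {X : Type*} [TopologicalSpace X] {F : Set X}
    (hF : IsClosed F) (x : X) : IsClosed (connectedComponentIn F x) := by
  by_cases hx : x ∈ F
  · rw [connectedComponentIn_eq_image hx]
    exact hF.isClosedEmbedding_subtypeVal.isClosedMap _ isClosed_connectedComponent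
  · rw [connectedComponentIn_eq_empty hx]
    exact isClosed_empty

lemma subset_infield {X : Type*} [PseudoMetricSpace X] (A : Set X) : A ⊆ infield A := by
  intro x hx
  simp [infield, connectedComponentIn_eq_empty (show x ∉ Aᶜ from not_not.2 hx)]

lemma image_infield {X : Type*} [PseudoMetricSpace X] (φ : X ≃ᵢ X) (A : Set X) :
    φ '' infield A = infield (φ '' A) := by
  ext y
  obtain ⟨x, rfl⟩ := φ.surjective y
  rw [φ.injective.mem_set_image]
  by_cases hx : x ∈ A
  · simp only [subset_infield A hx, subset_infield (φ '' A) (mem_image_of_mem φ hx)]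
  · have h1 := φ.toHomeomorph.image_connectedComponentIn (s := Aᶜ) hx
    have h2 : φ '' connectedComponentIn Aᶜ x = connectedComponentIn (φ '' A)ᶜ (φ x) := by
      rw [← image_compl_eq φ.bijective]
      exact h1
    simp only [infield, mem_ofPred_eq, ← h2, isBounded_image_iff_of_isometry φ.isometry]

lemma frontier_connectedComponentIn_compl_subset {X : Type*} [TopologicalSpace X]
    [LocallyConnectedSpace X] (A : Set X) (x : X) :
    frontier (connectedComponentIn Aᶜ x) ⊆ closure A := by
  intro y hy
  by_contra hyA
  obtain ⟨W, hWA, hWo, hyW, hWc⟩ := locallyConnectedSpace_iff_subsets_isOpen_isConnected.1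
    ‹_› y (closure A)ᶜ (isClosed_closure.isOpen_compl.mem_nhds hyA)
  have hWA' : W ⊆ Aᶜ := hWA.trans (compl_subset_compl.2 subset_closure)
  obtain ⟨z, hzW, hz⟩ := mem_closure_iff.1 (frontier_subset_closure hy) W hWo hyW
  have h1 : W ⊆ connectedComponentIn Aᶜ x := by
    rw [connectedComponentIn_eq hz]
    exact hWc.isPreconnected.subset_connectedComponentIn hzW hWA'
  exact hy.2 (mem_interior.2 ⟨W, h1, hWo, hyW⟩)

lemma subset_infield_or_subset_compl {X : Type*} [PseudoMetricSpace X] {A B : Set X}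
    (hB : IsPreconnected B) (h : Disjoint A B) : B ⊆ infield A ∨ B ⊆ (infield A)ᶜ := by
  by_contra! hcon
  obtain ⟨⟨y, hyB, hy⟩, ⟨x, hxB, hx⟩⟩ :=
    And.intro (not_subset.1 hcon.1) (not_subset.1 hcon.2)
  rw [mem_compl_iff, not_not] at hx
  have hBA : B ⊆ Aᶜ := h.symm.subset_compl_right
  apply hy
  have h1 : y ∈ connectedComponentIn Aᶜ x := hB.subset_connectedComponentIn hxB hBA hyB
  simpa only [infield, mem_ofPred_eq, connectedComponentIn_eq h1] using hx

lemma connectedComponentIn_subset_infield {X : Type*} [PseudoMetricSpace X] {A : Set X} {x : X}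
    (hx : x ∈ infield A) : connectedComponentIn Aᶜ x ⊆ infield A := by
  intro y hy
  simpa only [infield, mem_ofPred_eq, connectedComponentIn_eq hy] using hx

section NormedSpace

variable {E : Type*} [NormedAddCommGroup E] [NormedSpace ℝ E]

lemma isPreconnected_compl_ball (hE : 1 < Module.rank ℝ E) (c : E) {R : ℝ} (hR : 0 < R) :
    IsPreconnected (ball c R)ᶜ := by
  have h1 : IsPreconnected (Ici R ×ˢ sphere (0 : E) 1) :=
    isPreconnected_Ici.prod (isPreconnected_sphere hE 0 1)
  have h2 : (ball c R)ᶜ = (fun p : ℝ × E => c + p.1 • p.2) '' (Ici R ×ˢ sphere (0 : E) 1) := by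
    ext x
    simp only [mem_compl_iff, mem_ball, dist_eq_norm, not_lt, mem_image, mem_prod, mem_Ici,
      mem_sphere_zero_iff_norm, Prod.exists]
    constructor
    · intro hx
      have hx0 : ‖x - c‖ ≠ 0 := by linarith
      refine ⟨‖x - c‖, ‖x - c‖⁻¹ • (x - c), ⟨hx, ?_⟩, ?_⟩
      · rw [norm_smul, norm_inv, norm_norm, inv_mul_cancel₀ hx0]
      · rw [smul_inv_smul₀ hx0, add_sub_cancel]
    · rintro ⟨t, v, ⟨ht, hv⟩, rfl⟩
      rw [add_sub_cancel_left, norm_smul, hv, mul_one]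
      exact ht.trans (le_abs_self t)
  rw [h2]
  exact h1.image _ (by fun_prop)

lemma not_isBounded_compl_of_isBounded [Nontrivial E] {A : Set E} (hA : Bornology.IsBounded A) :
    ¬ Bornology.IsBounded Aᶜ := by
  intro h
  have := hA.union h
  rw [union_compl_self] at this
  exact NormedSpace.unbounded_univ ℝ E this

lemma infield_subset_ball (hE : 1 < Module.rank ℝ E) {A : Set E} {c : E} {R : ℝ} (hR : 0 < R)
    (hA : A ⊆ ball c R) : infield A ⊆ ball c R := by
  have : Nontrivial E := (rank_pos_iff_nontrivial (R := ℝ)).1 (zero_lt_one.trans hE)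
  intro x hx
  by_contra hxb
  refine not_isBounded_compl_of_isBounded (isBounded_ball (x := c) (r := R)) ?_
  exact Bornology.IsBounded.subset hx
    ((isPreconnected_compl_ball hE c hR).subset_connectedComponentIn hxb (compl_subset_compl.2 hA))

lemma isBounded_infield (hE : 1 < Module.rank ℝ E) {A : Set E} (hA : Bornology.IsBounded A) :
    Bornology.IsBounded (infield A) := by
  obtain ⟨R, hR⟩ := hA.subset_ball 0
  exact isBounded_ball.subset (infield_subset_ball hE (R := max R 1) (by positivity)
    (hR.trans (ball_subset_ball (le_max_left _ _))))

/-- In dimension at least two, the complement of a bounded set has exactly one unbounded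
component. -/
lemma exists_compl_infield_eq (hE : 1 < Module.rank ℝ E) {A : Set E}
    (hA : Bornology.IsBounded A) :
    ∃ x ∈ Aᶜ, (infield A)ᶜ = connectedComponentIn Aᶜ x := by
  have : Nontrivial E := (rank_pos_iff_nontrivial (R := ℝ)).1 (zero_lt_one.trans hE)
  obtain ⟨R, hR0, hR⟩ : ∃ R > 0, A ⊆ ball (0 : E) R := by
    obtain ⟨R, hR⟩ := hA.subset_ball 0
    exact ⟨max R 1, by positivity, hR.trans (ball_subset_ball (le_max_left _ _))⟩
  have hSA : (ball (0 : E) R)ᶜ ⊆ Aᶜ := compl_subset_compl.2 hR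
  have hSc := isPreconnected_compl_ball hE (0 : E) hR0
  have hSu := not_isBounded_compl_of_isBounded (isBounded_ball (x := (0 : E)) (r := R))
  obtain ⟨x, hx⟩ : ((ball (0 : E) R)ᶜ).Nonempty := by
    by_contra h
    rw [not_nonempty_iff_eq_empty] at h
    exact hSu (h ▸ Bornology.isBounded_empty)
  refine ⟨x, hSA hx, Subset.antisymm (fun y hy => ?_) fun y hy hy' => ?_⟩
  · have hyA : y ∈ Aᶜ := fun h => hy (subset_infield A h)
    obtain ⟨z, hz, hzR⟩ := not_subset.1 fun h =>
      hy (isBounded_ball.subset h : Bornology.IsBounded (connectedComponentIn Aᶜ y))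
    rw [connectedComponentIn_eq (hSc.subset_connectedComponentIn hx hSA hzR),
      ← connectedComponentIn_eq hz]
    exact mem_connectedComponentIn hyA
  · refine hSu (Bornology.IsBounded.subset hy' ?_)
    rw [← connectedComponentIn_eq hy]
    exact hSc.subset_connectedComponentIn hx hSA

lemma isPreconnected_compl_infield (hE : 1 < Module.rank ℝ E) {A : Set E}
    (hA : Bornology.IsBounded A) : IsPreconnected (infield A)ᶜ := by
  obtain ⟨x, -, hx⟩ := exists_compl_infield_eq hE hA
  rw [hx]
  exact isPreconnected_connectedComponentIn

lemma not_isBounded_connectedComponentIn_compl_infield (hE : 1 < Module.rank ℝ E) {A : Set E}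
    (hA : Bornology.IsBounded A) {x : E} (hx : x ∉ infield A) :
    ¬ Bornology.IsBounded (connectedComponentIn (infield A)ᶜ x) := by
  have : Nontrivial E := (rank_pos_iff_nontrivial (R := ℝ)).1 (zero_lt_one.trans hE)
  rw [(isPreconnected_compl_infield hE hA).connectedComponentIn hx]
  exact not_isBounded_compl_of_isBounded (isBounded_infield hE hA)

lemma isOpen_infield (hE : 1 < Module.rank ℝ E) {A : Set E} (hA : Bornology.IsBounded A)
    (hAo : IsOpen A) : IsOpen (infield A) := by
  obtain ⟨x, -, hx⟩ := exists_compl_infield_eq hE hA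
  rw [← isClosed_compl_iff, hx]
  exact isClosed_connectedComponentIn hAo.isClosed_compl x

lemma infield_infield (hE : 1 < Module.rank ℝ E) {A : Set E} (hA : Bornology.IsBounded A) :
    infield (infield A) = infield A :=
  Subset.antisymm (fun x hx => by
    by_contra hxA
    exact not_isBounded_connectedComponentIn_compl_infield hE hA hxA hx) (subset_infield _)

lemma eq_empty_of_isBounded_of_frontier_eq_empty [Nontrivial E] {C : Set E}
    (hC : Bornology.IsBounded C) (hf : frontier C = ∅) : C = ∅ := by
  rcases isClopen_iff.1 (isClopen_iff_frontier_eq_empty.2 hf) with h | h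
  · exact h
  · exact absurd (h ▸ hC) (NormedSpace.unbounded_univ ℝ E)

lemma isConnected_infield (hE : 1 < Module.rank ℝ E) {A : Set E} (hAo : IsOpen A)
    (hAc : IsConnected A) : IsConnected (infield A) := by
  have : Nontrivial E := (rank_pos_iff_nontrivial (R := ℝ)).1 (zero_lt_one.trans hE)
  obtain ⟨a, ha⟩ := hAc.nonempty
  refine ⟨⟨a, subset_infield A ha⟩, isPreconnected_of_forall a fun x hx => ?_⟩
  by_cases hxA : x ∈ A
  · exact ⟨A, subset_infield A, ha, hxA, hAc.isPreconnected⟩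
  -- a bounded component of the complement has a boundary point, which adheres to `A`
  set C := connectedComponentIn Aᶜ x with hC
  have hxC : x ∈ C := mem_connectedComponentIn hxA
  obtain ⟨b, hb⟩ : (frontier C).Nonempty := by
    rw [nonempty_iff_ne_empty]
    intro h
    have := eq_empty_of_isBounded_of_frontier_eq_empty hx h
    rw [← hC] at this
    simp [this] at hxC
  have hbC : b ∈ C := (isClosed_connectedComponentIn hAo.isClosed_compl x).frontier_subset hb
  have hbA : b ∈ closure A := frontier_connectedComponentIn_compl_subset A x hb
  have h1 : IsPreconnected (insert b A) :=
    hAc.isPreconnected.subset_closure (subset_insert b A) (insert_subset hbA subset_closure)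
  refine ⟨C ∪ insert b A, ?_, Or.inr (mem_insert_of_mem _ ha), Or.inl hxC,
    IsPreconnected.union b hbC (mem_insert b A) isPreconnected_connectedComponentIn h1⟩
  exact union_subset (connectedComponentIn_subset_infield hx)
    (insert_subset (connectedComponentIn_subset_infield hx hbC) (subset_infield A))

/-- Of two bounded sets with disjoint closures, one lying in the infield of the other has
the smaller infield, and this infield misses the enclosing set if the latter is connected. -/
lemma infield_subset_infield_of_subset (hE : 1 < Module.rank ℝ E) {A B : Set E}
    (hA : IsConnected A) (hAb : Bornology.IsBounded A) (hBb : Bornology.IsBounded B)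
    (hAB : Disjoint (closure A) (closure B)) (h : B ⊆ infield A) :
    infield B ⊆ infield A ∧ Disjoint (infield B) A := by
  have : Nontrivial E := (rank_pos_iff_nontrivial (R := ℝ)).1 (zero_lt_one.trans hE)
  have hdisj : Disjoint A B := hAB.mono subset_closure subset_closure
  have step : ∀ A B : Set E, Bornology.IsBounded A → B ⊆ infield A → infield B ⊆ infield A := by
    intro A B hAb h x hx
    by_contra hxA
    refine not_isBounded_compl_of_isBounded (isBounded_infield hE hAb)
      (Bornology.IsBounded.subset hx ?_)
    exact (isPreconnected_compl_infield hE hAb).subset_connectedComponentIn hxA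
      (compl_subset_compl.2 h)
  have hsub := step A B hAb h
  refine ⟨hsub, ?_⟩
  rcases subset_infield_or_subset_compl hA.isPreconnected hdisj.symm with h' | h'
  · have heq : infield A = infield B := (step B A hBb h').antisymm hsub
    have hfr : ∀ D : Set E, Bornology.IsBounded D → frontier (infield D) ⊆ closure D := by
      intro D hD
      obtain ⟨x, -, hx⟩ := exists_compl_infield_eq hE hD
      rw [← frontier_compl, hx]
      exact frontier_connectedComponentIn_compl_subset D x
    have hempty : frontier (infield A) = ∅ := by
      rw [← subset_empty_iff]
      exact fun y hy => disjoint_left.1 hAB (hfr A hAb hy) (hfr B hBb (heq ▸ hy))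
    have hA0 := eq_empty_of_isBounded_of_frontier_eq_empty (isBounded_infield hE hAb) hempty
    obtain ⟨a, ha⟩ := hA.nonempty
    exact absurd (subset_infield A ha) (hA0 ▸ notMem_empty a)
  · exact disjoint_right.2 fun x hx => h' hx

/-- Two sets with disjoint closures, each lying outside the infield of the other, have disjoint
infields: a common point would lie in the same bounded component of both complements. -/
lemma disjoint_infield_of_subset_compl (hE : 1 < Module.rank ℝ E) {A B : Set E}
    (hAB : Disjoint (closure A) (closure B)) (hB : B ⊆ (infield A)ᶜ) (hA : A ⊆ (infield B)ᶜ) :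
    Disjoint (infield A) (infield B) := by
  have : Nontrivial E := (rank_pos_iff_nontrivial (R := ℝ)).1 (zero_lt_one.trans hE)
  rw [disjoint_left]
  intro x hxA hxB
  have hxA' : x ∈ Aᶜ := fun h => hA h hxB
  have hxB' : x ∈ Bᶜ := fun h => hB h hxA
  have step : ∀ A B : Set E, x ∈ infield A → x ∈ Aᶜ → B ⊆ (infield A)ᶜ →
      connectedComponentIn Aᶜ x ⊆ connectedComponentIn Bᶜ x := by
    intro A B hx hx' hB
    refine isPreconnected_connectedComponentIn.subset_connectedComponentIn
      (mem_connectedComponentIn hx') ?_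
    exact (connectedComponentIn_subset_infield hx).trans (subset_compl_comm.1 hB)
  have heq := (step A B hxA hxA' hB).antisymm (step B A hxB hxB' hA)
  have hempty : frontier (connectedComponentIn Aᶜ x) = ∅ := by
    rw [← subset_empty_iff]
    intro y hy
    exact disjoint_left.1 hAB (frontier_connectedComponentIn_compl_subset A x hy)
      (frontier_connectedComponentIn_compl_subset B x (heq ▸ hy))
  have h1 := eq_empty_of_isBounded_of_frontier_eq_empty hxA hempty
  have h2 := mem_connectedComponentIn hxA'
  simp [h1] at h2

/-- Congruent open connected bounded sets with disjoint closures are not nested, as this would make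
the infield of the enclosing set have larger volume. -/
lemma disjoint_infield_of_image_eq [FiniteDimensional ℝ E] (hE : 1 < Module.rank ℝ E) {A B : Set E}
    (hA : IsConnected A) (hAb : Bornology.IsBounded A) (hAo : IsOpen A) (φ : E ≃ᵢ E)
    (hφ : φ '' A = B) (hAB : Disjoint (closure A) (closure B)) :
    Disjoint (infield A) (infield B) := by
  borelize E
  let μ : Measure E := Measure.hausdorffMeasure (Module.finrank ℝ E)
  have key : ∀ (A B : Set E) (φ : E ≃ᵢ E), IsConnected A → Bornology.IsBounded A → IsOpen A →
      φ '' A = B → Disjoint (closure A) (closure B) → ¬ B ⊆ infield A := by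
    rintro A B φ hA hAb hAo rfl hAB hBA
    obtain ⟨h1, h2⟩ := infield_subset_infield_of_subset hE hA hAb
      (φ.isometry.lipschitz.isBounded_image hAb) hAB hBA
    have h3 : μ (infield (φ '' A)) = μ (infield A) := by
      rw [← image_infield]
      exact φ.isometry.hausdorffMeasure_image (Or.inl (Nat.cast_nonneg _)) _
    have h4 : μ (infield (φ '' A)) + μ A ≤ μ (infield A) := by
      rw [← measure_union h2 hAo.measurableSet]
      exact measure_mono (union_subset h1 (subset_infield A))
    have h5 : 0 < μ A := hAo.measure_pos μ hA.nonempty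
    have h6 : μ (infield A) < ∞ := (isBounded_infield hE hAb).measure_lt_top
    rw [h3] at h4
    exact absurd (ENNReal.lt_add_right h6.ne h5.ne') (not_lt.2 h4)
  have hdisj : Disjoint A B := hAB.mono subset_closure subset_closure
  have hB : IsConnected B := hφ ▸ hA.image φ φ.continuous.continuousOn
  have hBA := (subset_infield_or_subset_compl hB.isPreconnected hdisj).resolve_left
    (key A B φ hA hAb hAo hφ hAB)
  have hφ' : φ.symm '' B = A := by rw [← hφ, image_image]; simp
  have hAB' := (subset_infield_or_subset_compl hA.isPreconnected hdisj.symm).resolve_left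
    (key B A φ.symm hB (hφ ▸ φ.isometry.lipschitz.isBounded_image hAb)
      (hφ ▸ φ.toHomeomorph.isOpenMap A hAo) hφ' hAB.symm)
  exact disjoint_infield_of_subset_compl hE hAB hBA hAB'

end NormedSpace

/-- The infield of a bounded connected open subset of the plane is an open disk. -/
theorem isOpenDisk_infield {A : Set (EuclideanSpace ℝ (Fin 2))} (hA : Bornology.IsBounded A)
    (hAo : IsOpen A) (hAc : IsConnected A) : IsOpenDisk (infield A) := by
  have hE : 1 < Module.rank ℝ (EuclideanSpace ℝ (Fin 2)) := by
    rw [← Module.finrank_eq_rank, finrank_euclideanSpace_fin]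
    norm_num
  refine ⟨isOpen_infield hE hA hAo, ?_⟩
  let e : EuclideanSpace ℝ (Fin 2) ≃ₗᵢ[ℝ] ℂ := Complex.orthonormalBasisOneI.repr.symm
  set U : Set ℂ := e '' infield A with hU
  have hUo : IsOpen U := e.toHomeomorph.isOpenMap _ (isOpen_infield hE hA hAo)
  have hUc : IsConnected U := (isConnected_infield hE hAo hAc).image e e.continuous.continuousOn
  have hUb : Bornology.IsBounded U := e.lipschitz.isBounded_image (isBounded_infield hE hA)
  have hUcomp : ∀ z ∉ U, ¬ Bornology.IsBounded (connectedComponentIn Uᶜ z) := by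
    intro z hz
    obtain ⟨x, rfl⟩ := e.surjective z
    have hx : x ∉ infield A := fun h => hz (mem_image_of_mem e h)
    have h1 : e '' connectedComponentIn (infield A)ᶜ x = connectedComponentIn Uᶜ (e x) := by
      rw [hU, ← image_compl_eq e.bijective]
      exact e.toHomeomorph.image_connectedComponentIn hx
    rw [← h1, isBounded_image_iff_of_isometry e.isometry]
    exact not_isBounded_connectedComponentIn_compl_infield hE hA hx
  obtain ⟨ψ⟩ := nonempty_homeomorph_ball_of_compl hUo hUc hUb hUcomp
  have hball : e '' ball 0 1 = ball (0 : ℂ) 1 := by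
    rw [e.image_ball, map_zero]
  exact ⟨((e.toHomeomorph.image (infield A)).trans ψ).trans
    ((Homeomorph.setCongr hball).symm.trans (e.toHomeomorph.image (ball 0 1)).symm)⟩

end QuasiPattern

end

/-! ### Symmetric thickenings of quasi-patterns -/

section

open Set Filter Topology MeasureTheory Metric
open scoped Pointwise

namespace QuasiPattern

/-- The open `r`-neighbourhood of the union of all images `φ '' M k`, `φ ∈ G`, that are `r`-close
to the member `M i`. -/
def orbitThickening {X ι : Type*} [PseudoMetricSpace X] (M : ι → Set X) (G : Subgroup (X ≃ᵢ X))
    (r : ℝ) (i : ι) : Set X :=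
  {x | ∃ φ ∈ G, ∃ k, hausdorffEDist (φ '' M k) (M i) < ENNReal.ofReal r ∧
    x ∈ thickening r (φ '' M k)}

lemma image_mul {X : Type*} [PseudoMetricSpace X] (φ ψ : X ≃ᵢ X) (A : Set X) :
    (φ * ψ) '' A = φ '' (ψ '' A) := by
  rw [image_image]
  rfl

lemma hausdorffEDist_inv_image {X : Type*} [PseudoMetricSpace X] (φ : X ≃ᵢ X) (A B : Set X) :
    hausdorffEDist (⇑(φ⁻¹) '' B) A = hausdorffEDist (φ '' A) B := by
  rw [← hausdorffEDist_image φ.isometry, ← image_mul, mul_inv_cancel, hausdorffEDist_comm]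
  simp

lemma exists_hausdorffEDist_lt {X ι : Type*} [PseudoMetricSpace X] {M : ι → Set X}
    {G : Subgroup (X ≃ᵢ X)} {δ r : ℝ} (hG : IsSymmetryGroup δ M G) (hδ : 0 ≤ δ) (hr : δ < r)
    {φ : X ≃ᵢ X} (hφ : φ ∈ G) (i : ι) :
    ∃ j, hausdorffEDist (φ '' M i) (M j) < ENNReal.ofReal r := by
  have h1 : (⨅ j, hausdorffEDist (φ '' M i) (M j)) ≤ ENNReal.ofReal δ :=
    (le_iSup (fun i => ⨅ j, hausdorffEDist (φ '' M i) (M j)) i).trans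
      (le_sup_left.trans (hG φ hφ))
  exact iInf_lt_iff.1 (h1.trans_lt ((ENNReal.ofReal_lt_ofReal_iff (hδ.trans_lt hr)).2 hr))

section

variable {X ι : Type*} [PseudoMetricSpace X] {M : ι → Set X} {G : Subgroup (X ≃ᵢ X)} {r d : ℝ}

lemma eq_of_hausdorffEDist_lt (hM : ∀ i, (M i).Nonempty)
    (hd : ∀ i j, i ≠ j → ENNReal.ofReal d ≤ setDist (M i) (M j)) {i j : ι}
    (h : hausdorffEDist (M i) (M j) < ENNReal.ofReal d) : i = j := by
  by_contra hij
  obtain ⟨a, ha⟩ := hM i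
  obtain ⟨b, hb, hab⟩ := exists_edist_lt_of_hausdorffEDist_lt ha h
  have h1 : setDist (M i) (M j) ≤ edist a b := iInf₂_le_of_le a ha (iInf₂_le b hb)
  exact absurd ((hd i j hij).trans h1) (not_le.2 hab)

lemma subset_orbitThickening (hr : 0 < r) (i : ι) : M i ⊆ orbitThickening M G r i := by
  intro x hx
  refine ⟨1, G.one_mem, i, ?_, ?_⟩
  · simpa using hr
  · simpa using self_subset_thickening hr (M i) hx

lemma isOpen_orbitThickening (i : ι) : IsOpen (orbitThickening M G r i) := by
  have : orbitThickening M G r i =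
      ⋃ φ ∈ G, ⋃ k, ⋃ _ : hausdorffEDist (φ '' M k) (M i) < ENNReal.ofReal r,
        thickening r (φ '' M k) := by
    ext x
    simp [orbitThickening]
  rw [this]
  exact isOpen_biUnion fun _ _ => isOpen_iUnion fun _ => isOpen_iUnion fun _ => isOpen_thickening

lemma orbitThickening_subset (i : ι) :
    orbitThickening M G r i ⊆ thickening (2 * r) (M i) := by
  rintro x ⟨φ, -, k, hk, hx⟩
  obtain ⟨y, hy, hxy⟩ := mem_thickening_iff.1 hx
  obtain ⟨z, hz, hyz⟩ := exists_edist_lt_of_hausdorffEDist_lt hy hk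
  rw [edist_lt_ofReal] at hyz
  exact mem_thickening_iff.2 ⟨z, hz, by linarith [dist_triangle x y z]⟩

lemma isBounded_orbitThickening {i : ι} (hM : Bornology.IsBounded (M i)) :
    Bornology.IsBounded (orbitThickening M G r i) :=
  hM.thickening.subset (orbitThickening_subset i)

lemma disjoint_closure_orbitThickening (hr : 0 < r) (hrd : 4 * r < d)
    (hd : ∀ i j, i ≠ j → ENNReal.ofReal d ≤ setDist (M i) (M j)) {i j : ι} (hij : i ≠ j) :
    Disjoint (closure (orbitThickening M G r i)) (closure (orbitThickening M G r j)) := by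
  have h : ∀ i, closure (orbitThickening M G r i) ⊆ thickening (d / 2) (M i) := fun i =>
    (closure_mono (orbitThickening_subset i)).trans
      ((closure_thickening_subset_cthickening _ _).trans
        (cthickening_subset_thickening' (by linarith) (by linarith) _))
  rw [disjoint_left]
  intro x hxi hxj
  obtain ⟨a, ha, hxa⟩ := mem_thickening_iff.1 (h i hxi)
  obtain ⟨b, hb, hxb⟩ := mem_thickening_iff.1 (h j hxj)
  have h1 : setDist (M i) (M j) ≤ edist a b := iInf₂_le_of_le a ha (iInf₂_le b hb)
  have h2 : edist a b < ENNReal.ofReal d := by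
    rw [edist_lt_ofReal]
    linarith [dist_triangle_left a b x]
  exact absurd ((hd i j hij).trans h1) (not_le.2 h2)

/-- The thickenings are permuted exactly by `G`: three almost coincidences up to `r` still determine
the member, since distinct members are more than `3 * r` apart. -/
lemma image_orbitThickening (hr : 0 < r) (hrd : 4 * r < d) (hM : ∀ i, (M i).Nonempty)
    (hd : ∀ i j, i ≠ j → ENNReal.ofReal d ≤ setDist (M i) (M j))
    (hG : ∀ φ ∈ G, ∀ i, ∃ j, hausdorffEDist (φ '' M i) (M j) < ENNReal.ofReal r)
    {φ : X ≃ᵢ X} (hφ : φ ∈ G) {i j : ι}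
    (hij : hausdorffEDist (φ '' M i) (M j) < ENNReal.ofReal r) :
    φ '' orbitThickening M G r i = orbitThickening M G r j := by
  have step : ∀ φ ∈ G, ∀ i j, hausdorffEDist (φ '' M i) (M j) < ENNReal.ofReal r →
      ∀ x ∈ orbitThickening M G r i, φ x ∈ orbitThickening M G r j := by
    rintro φ hφ i j hij x ⟨ψ, hψ, k, hk, hx⟩
    obtain ⟨l, hl⟩ := hG (φ * ψ) (G.mul_mem hφ hψ) k
    have h1 : hausdorffEDist (φ '' M i) ((φ * ψ) '' M k) < ENNReal.ofReal r := by
      rwa [image_mul, hausdorffEDist_image φ.isometry, hausdorffEDist_comm]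
    have h2 : hausdorffEDist (M j) (M l) < ENNReal.ofReal d := by
      calc hausdorffEDist (M j) (M l)
          ≤ hausdorffEDist (M j) (φ '' M i) + hausdorffEDist (φ '' M i) (M l) :=
            hausdorffEDist_triangle
        _ ≤ hausdorffEDist (M j) (φ '' M i) + (hausdorffEDist (φ '' M i) ((φ * ψ) '' M k) +
              hausdorffEDist ((φ * ψ) '' M k) (M l)) := by
            gcongr
            exact hausdorffEDist_triangle
        _ ≤ ENNReal.ofReal r + (ENNReal.ofReal r + ENNReal.ofReal r) := by
            rw [hausdorffEDist_comm]
            gcongr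
        _ < ENNReal.ofReal d := by
            rw [← ENNReal.ofReal_add hr.le hr.le, ← ENNReal.ofReal_add hr.le (by positivity),
              ENNReal.ofReal_lt_ofReal_iff (by linarith)]
            linarith
    obtain rfl := eq_of_hausdorffEDist_lt hM hd h2
    refine ⟨φ * ψ, G.mul_mem hφ hψ, k, hl, ?_⟩
    obtain ⟨y, hy, hxy⟩ := mem_thickening_iff.1 hx
    refine mem_thickening_iff.2 ⟨φ y, ?_, by rwa [φ.dist_eq]⟩
    rw [image_mul]
    exact mem_image_of_mem φ hy
  refine Subset.antisymm (image_subset_iff.2 (step φ hφ i j hij)) fun y hy => ?_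
  refine ⟨φ⁻¹ y, step φ⁻¹ (G.inv_mem hφ) j i ?_ y hy, φ.apply_symm_apply y⟩
  rwa [hausdorffEDist_inv_image]

end

lemma isConnected_thickening {E : Type*} [NormedAddCommGroup E] [NormedSpace ℝ E] {A : Set E}
    (hA : IsConnected A) {r : ℝ} (hr : 0 < r) : IsConnected (thickening r A) := by
  have h : thickening r A = (fun p : E × E => p.1 + p.2) '' (A ×ˢ ball (0 : E) r) := by
    rw [Set.add_image_prod, add_ball_zero]
  have hb : IsConnected (ball (0 : E) r) := (convex_ball _ _).isConnected ⟨0, mem_ball_self hr⟩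
  rw [h]
  exact (hA.prod hb).image _ continuous_add.continuousOn

lemma isConnected_orbitThickening {E ι : Type*} [NormedAddCommGroup E] [NormedSpace ℝ E]
    {M : ι → Set E} {G : Subgroup (E ≃ᵢ E)} {r : ℝ} (hr : 0 < r)
    (hM : ∀ i, IsConnected (M i)) (i : ι) : IsConnected (orbitThickening M G r i) := by
  obtain ⟨a, ha⟩ := (hM i).nonempty
  refine ⟨⟨a, subset_orbitThickening hr i ha⟩, isPreconnected_of_forall a ?_⟩
  rintro x ⟨φ, hφ, k, hk, hx⟩
  refine ⟨thickening r (φ '' M k), fun y hy => ⟨φ, hφ, k, hk, hy⟩, ?_, hx,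
    (isConnected_thickening ((hM k).image φ φ.continuous.continuousOn) hr).isPreconnected⟩
  rw [hausdorffEDist_comm] at hk
  obtain ⟨b, hb, hab⟩ := exists_edist_lt_of_hausdorffEDist_lt ha hk
  exact mem_thickening_iff.2 ⟨b, hb, edist_lt_ofReal.1 hab⟩

/-- A discrete connected quasi-pattern in the plane is engulfed by an exactly symmetric pattern of
separated open disks. -/
theorem exists_engulfing_open_disks {δ d₀ ε₀ : ℝ} (hδ : 0 ≤ δ) (hε₀ : 0 < ε₀)
    (hε₀' : ε₀ < (d₀ - 4 * δ) / 2) {I : Type*} {M : I → Set (EuclideanSpace ℝ (Fin 2))}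
    {G : Subgroup (EuclideanSpace ℝ (Fin 2) ≃ᵢ EuclideanSpace ℝ (Fin 2))}
    (hP : IsPattern δ δ M G) (hD : IsDiscreteFamily d₀ M) (hC : IsConnectedFamily M) :
    ∃ N : I → Set (EuclideanSpace ℝ (Fin 2)), IsPattern (4 * δ + 2 * ε₀) 0 N G ∧
      EngulfsWith δ (4 * δ + 2 * ε₀) N M G G ∧ IsSeparated N ∧ IsFineDistributed N ∧
      ∀ i, IsOpenDisk (N i) := by
  have hE : 1 < Module.rank ℝ (EuclideanSpace ℝ (Fin 2)) := by
    rw [← Module.finrank_eq_rank, finrank_euclideanSpace_fin]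
    norm_num
  -- a margin above `δ`, as the infima defining `δ`-symmetries need not be attained
  set r : ℝ := δ + ε₀ / 2 with hr
  have hr0 : 0 < r := by positivity
  have hδr : δ < r := by linarith
  have hrd : 4 * r < d₀ := by linarith
  have hd : ∀ i j, i ≠ j → ENNReal.ofReal d₀ ≤ setDist (M i) (M j) := fun i j hij => by
    rw [← hD.iInf_setDist]
    exact iInf_le_of_le i (iInf₂_le j hij)
  have hG : ∀ φ ∈ G, ∀ i, ∃ j, hausdorffEDist (φ '' M i) (M j) < ENNReal.ofReal r :=
    fun φ hφ i => exists_hausdorffEDist_lt hP.isSymmetryGroup hδ hδr hφ i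
  set T := orbitThickening M G r with hT
  have hTo : ∀ i, IsOpen (T i) := isOpen_orbitThickening
  have hTc : ∀ i, IsConnected (T i) := isConnected_orbitThickening hr0 hC
  have hTb : ∀ i, Bornology.IsBounded (T i) := fun i => isBounded_orbitThickening (hD.bounded i)
  have himg : ∀ φ ∈ G, ∀ i j, hausdorffEDist (φ '' M i) (M j) < ENNReal.ofReal r →
      φ '' infield (T i) = infield (T j) := fun φ hφ i j hij => by
    rw [image_infield, hT, image_orbitThickening hr0 hrd hP.nonempty hd hG hφ hij]
  obtain ⟨g, hg, hg'⟩ := hP.exists_transfer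
  have hgr : ∀ i j, hausdorffEDist (g i j '' M j) (M i) < ENNReal.ofReal r := fun i j => by
    rw [hausdorffEDist_comm]
    exact (hg i j).2.trans_lt ((ENNReal.ofReal_lt_ofReal_iff hr0).2 hδr)
  have hdisj : ∀ i j, i ≠ j → Disjoint (infield (T i)) (infield (T j)) := fun i j hij =>
    disjoint_infield_of_image_eq hE (hTc i) (hTb i) (hTo i) (g j i)
      (image_orbitThickening hr0 hrd hP.nonempty hd hG (hg j i).1 (hgr j i))
      (disjoint_closure_orbitThickening hr0 hrd hd hij)
  have hsub : ∀ i, M i ⊆ infield (T i) := fun i =>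
    (subset_orbitThickening hr0 i).trans (subset_infield _)
  have hsym : IsSymmetryGroup (4 * δ + 2 * ε₀) (fun i => infield (T i)) G := by
    intro φ hφ
    refine (sup_le (iSup_le fun i => ?_) (iSup_le fun j => ?_)).trans (zero_le)
    · obtain ⟨j, hj⟩ := hG φ hφ i
      refine iInf_le_of_le j ?_
      change hausdorffEDist (φ '' infield (T i)) (infield (T j)) ≤ 0
      rw [himg φ hφ i j hj, hausdorffEDist_self]
    · obtain ⟨i, hi⟩ := hG φ⁻¹ (G.inv_mem hφ) j
      rw [hausdorffEDist_inv_image] at hi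
      refine iInf_le_of_le i ?_
      change hausdorffEDist (φ '' infield (T i)) (infield (T j)) ≤ 0
      rw [himg φ hφ i j hi, hausdorffEDist_self]
  refine ⟨fun i => infield (T i), ⟨hP.nonempty_index, fun i => (hP.nonempty i).mono (hsub i), hsym,
    hdisj, g, fun i j => ⟨(hg i j).1, ?_⟩, hg'⟩, ⟨hsub, hP.isSymmetryGroup, hsym, le_rfl⟩,
    fun i j hij => ?_, ?_, fun i => isOpenDisk_infield (hTb i) (hTo i) (hTc i)⟩
  · rw [himg (g i j) (hg i j).1 j i (hgr i j), hausdorffEDist_self]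
    exact zero_le
  · rw [infield_infield hE (hTb i), infield_infield hE (hTb j)]
    exact hdisj i j hij
  · obtain ⟨i₀⟩ := hP.nonempty_index
    obtain ⟨x, hx⟩ := (hTc i₀).nonempty
    obtain ⟨r₀, hr₀, hr₀T⟩ := Metric.isOpen_iff.1 (isOpen_infield hE (hTb i₀) (hTo i₀)) x
      (subset_infield _ hx)
    obtain ⟨R, hR⟩ := (isBounded_infield hE (hTb i₀)).subset_ball x
    refine ⟨r₀, max R 1, hr₀, by positivity, fun i => ?_⟩
    have hi : infield (infield (T i)) = g i i₀ '' infield (T i₀) := by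
      rw [infield_infield hE (hTb i), himg (g i i₀) (hg i i₀).1 i₀ i (hgr i i₀)]
    simp only [hi]
    refine ⟨⟨g i i₀ x, ?_⟩, ⟨g i i₀ x, ?_⟩⟩
    · rw [← IsometryEquiv.image_ball]
      exact image_mono hr₀T
    · rw [← IsometryEquiv.image_ball]
      exact image_mono (hR.trans (ball_subset_ball (le_max_left _ _)))

lemma IsOpenDisk.isConnected {A : Set (EuclideanSpace ℝ (Fin 2))} (hA : IsOpenDisk A) :
    IsConnected A := by
  obtain ⟨-, ⟨e⟩⟩ := hA
  have : ConnectedSpace (ball (0 : EuclideanSpace ℝ (Fin 2)) 1) :=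
    Subtype.connectedSpace ((convex_ball _ _).isConnected ⟨0, mem_ball_self one_pos⟩)
  exact isConnected_iff_connectedSpace.2 (e.symm.surjective.connectedSpace e.symm.continuous)

end QuasiPattern

end

theorem proposition5p2p6 (δ d₀ ε₀ : ℝ) (hδ : 0 ≤ δ) (hd₀ : 4 * δ < d₀) (hε₀ : 0 < ε₀)
    (hε₀' : ε₀ < (d₀ - 4 * δ) / 2) :
    ∃ ε₁ : ℝ, 0 < ε₁ ∧
      ∀ (I : Type*) (M : I → Set (EuclideanSpace ℝ (Fin 2)))
        (G₁ : Subgroup (EuclideanSpace ℝ (Fin 2) ≃ᵢ EuclideanSpace ℝ (Fin 2))),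
        QuasiPattern.IsPattern δ δ M G₁ →
        QuasiPattern.IsDiscreteFamily d₀ M →
        QuasiPattern.IsConnectedFamily M →
        (∃ (N : I → Set (EuclideanSpace ℝ (Fin 2)))
            (G₂ : Subgroup (EuclideanSpace ℝ (Fin 2) ≃ᵢ EuclideanSpace ℝ (Fin 2))),
            QuasiPattern.IsPattern (4 * δ + 2 * ε₀) 0 N G₂ ∧
            QuasiPattern.EngulfsWith δ (4 * δ + 2 * ε₀) N M G₁ G₂ ∧
            QuasiPattern.IsSeparated N ∧
            QuasiPattern.IsFineDistributed N ∧
            QuasiPattern.IsConnectedFamily N) ∧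
        (∀ ε : ℝ, 0 < ε → ε < ε₁ →
          (∃ i₀, QuasiPattern.IsExteriorOpenTopologyFree (5 * δ + 3 * ε₀ + ε) (M i₀)) →
          ∃ (N : I → Set (EuclideanSpace ℝ (Fin 2)))
            (G₂ : Subgroup (EuclideanSpace ℝ (Fin 2) ≃ᵢ EuclideanSpace ℝ (Fin 2))),
            QuasiPattern.IsPattern (4 * δ + 2 * ε₀) 0 N G₂ ∧
            QuasiPattern.EngulfsWith δ (4 * δ + 2 * ε₀) N M G₁ G₂ ∧
            QuasiPattern.IsSeparated N ∧
            QuasiPattern.IsFineDistributed N ∧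
            ∀ i, QuasiPattern.IsOpenDisk (N i)) := by
  -- the disks are constructed independently of `ε`, so any positive bound serves as `ε₁`
  refine ⟨1, one_pos, fun I M G₁ hP hD hC => ?_⟩
  obtain ⟨N, h1, h2, h3, h4, h5⟩ :=
    QuasiPattern.exists_engulfing_open_disks hδ hε₀ hε₀' hP hD hC
  exact ⟨⟨N, G₁, h1, h2, h3, h4, fun i => (h5 i).isConnected⟩,
    fun _ _ _ _ => ⟨N, G₁, h1, h2, h3, h4, h5⟩⟩
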